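/- Let $N\ge 1$ be an integer, let $U(N)$ be the group of $N\times N$ complex unitary matrices with identity $I$, and let $\sigma$ be the Haar probability measure on $U(N)$. For a complex $N\times N$ matrix $M=(m_{ij})$ let $\|M\|=\bigl(\sum_{i,j=1}^N |m_{ij}|^2\bigr)^{1/2}$ be its Hilbert–Schmidt norm. Then \[ \lim_{\delta\downarrow 0}\frac{\sigma(\{U\in U(N):\|I-U\|\le\delta\})}{\delta^{N^2}} =\frac{\prod_{j=1}^{N-1} j!}{(2\pi)^{N/2}\,2^{N^2/2}\,\Gamma(N^2/2+1)}\,, \] where the empty product (for $N=1$) equals $1$. -/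

import Mathlib

open MeasureTheory Filter Topology

open scoped Nat

/-- The Hilbert–Schmidt norm `(∑ᵢⱼ |mᵢⱼ|²)^{1/2}` of a complex square matrix. -/
noncomputable def hsNorm {N : ℕ} (M : Matrix (Fin N) (Fin N) ℂ) : ℝ :=
  √(∑ i, ∑ j, ‖M i j‖ ^ 2)

/-- `hsNorm` is Mathlib's Frobenius norm. -/
theorem hsNorm_eq_frobenius {N : ℕ} (M : Matrix (Fin N) (Fin N) ℂ) :
    hsNorm M = Matrix.frobeniusNormedAddCommGroup.toNorm.norm M := by
  rw [hsNorm, Matrix.frobenius_norm_def, Real.sqrt_eq_rpow]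
  norm_cast

/-! The size of a small ball around I is read off from high moments of X(U) = |det((1 + U)/2)|², a
variable in [0, 1] that equals 1 only at U = I (`normSqDetHalf`).

The eigenvalues y of (1 + U)*(1 + U)/4 lie in [0, 1], have product X, and satisfy ∑ (1 - y) = ‖I -
U‖²/4. Hence 1 - ‖I - U‖²/4 ≤ X ≤ exp(-‖I - U‖²/4) (`normSqDetHalf_bounds`), and the ball of radius
δ lies between {X ≥ exp(-δ²/4)} and {X ≥ 1 - δ²/4}.

The moments of X are explicit (`integral_norm_det_one_add_pow`): clearing the first row of 1 + U
gives det(1 + U) = (1 + U₀₀) det(1 + V), where V is again unitary, Haar distributed in dimension one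
less, and uncorrelated with functions of U₀₀; the moments of 1 + U₀₀ follow from invariance alone.
By Wallis' product the k-th moment of X is asymptotic to C k^(-N²/2), and Karamata's theorem
(`tendsto_measureReal_exp_neg_le_div_rpow`) turns this into the measure of {X ≥ exp(-r)} as r ↓ 0.
-/

section Tauberian

/-! ### Karamata's Tauberian theorem on [0, 1]. -/

variable {Ω : Type*} [MeasurableSpace Ω] {μ : Measure Ω} [IsFiniteMeasure μ] {X : Ω → ℝ}

theorem integrable_continuous_comp_of_mem_Icc (hX : Measurable X) (h01 : ∀ ω, X ω ∈ Set.Icc (0 : ℝ) 1)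
    {h : ℝ → ℝ} (hh : Continuous h) : Integrable (fun ω => h (X ω)) μ := by
  obtain ⟨M, hM⟩ := isCompact_Icc.exists_bound_of_continuousOn (hh.continuousOn (s := Set.Icc (0 : ℝ) 1))
  exact Integrable.of_bound (hh.measurable.comp hX).aestronglyMeasurable M
    (Eventually.of_forall fun ω => hM _ (h01 ω))

theorem integrableOn_gamma_weight_mul_comp_exp {α : ℝ} (hα : 0 < α) {h : ℝ → ℝ} (hh : Continuous h) :
    IntegrableOn (fun t : ℝ => Real.exp (-t) * t ^ (α - 1) * h (Real.exp (-t))) (Set.Ioi 0) := by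
  obtain ⟨M, hM⟩ := isCompact_Icc.exists_bound_of_continuousOn (hh.continuousOn (s := Set.Icc (0 : ℝ) 1))
  refine (Real.GammaIntegral_convergent hα).mul_bdd (c := M) ?_ ?_
  · exact (by fun_prop : Continuous fun t : ℝ => h (Real.exp (-t))).aestronglyMeasurable
  · refine (ae_restrict_iff' measurableSet_Ioi).2 (Eventually.of_forall fun t ht => hM _ ⟨?_, ?_⟩)
    · positivity
    · exact Real.exp_le_one_iff.2 (by have : (0 : ℝ) < t := ht; linarith)

theorem integral_gamma_weight_mul_exp_pow {α : ℝ} (hα : 0 < α) (m : ℕ) :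
    ∫ t in Set.Ioi (0 : ℝ), Real.exp (-t) * t ^ (α - 1) * Real.exp (-t) ^ m =
      Real.Gamma α * ((m : ℝ) + 1) ^ (-α) := by
  have hm : (0 : ℝ) < (m : ℝ) + 1 := by positivity
  have h := Real.integral_rpow_mul_exp_neg_mul_Ioi hα hm
  rw [one_div, Real.inv_rpow hm.le, ← Real.rpow_neg hm.le] at h
  rw [mul_comm, ← h]
  refine setIntegral_congr_fun measurableSet_Ioi fun t _ => ?_
  have : Real.exp (-(((m : ℝ) + 1) * t)) = Real.exp (-t) * Real.exp (-t) ^ m := by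
    rw [← Real.exp_nat_mul, ← Real.exp_add]; congr 1; ring
  simp only [this]; ring

/-- By linearity a monomial x ^ m suffices. It produces the moment of order (m + 1) k, so the
hypothesis along that subsequence gives the factor (m + 1) ^ (-α), which is also the one in the
Gamma integral. -/
theorem tendsto_rpow_mul_integral_pow_mul_polynomial {α C : ℝ} (hα : 0 < α) (hX : Measurable X)
    (h01 : ∀ ω, X ω ∈ Set.Icc (0 : ℝ) 1)
    (hC : Tendsto (fun k : ℕ => (k : ℝ) ^ α * ∫ ω, X ω ^ k ∂μ) atTop (𝓝 C)) (p : Polynomial ℝ) :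
    Tendsto (fun k : ℕ => (k : ℝ) ^ α * ∫ ω, X ω ^ k * p.eval (X ω ^ k) ∂μ) atTop
      (𝓝 (C / Real.Gamma α *
        ∫ t in Set.Ioi (0 : ℝ), Real.exp (-t) * t ^ (α - 1) * p.eval (Real.exp (-t)))) := by
  have hΓ : Real.Gamma α ≠ 0 := (Real.Gamma_pos_of_pos hα).ne'
  induction p using Polynomial.induction_on' with
  | add p q hp hq =>
    have key := hp.add hq
    rw [← mul_add, ← integral_add (integrableOn_gamma_weight_mul_comp_exp hα p.continuous)
      (integrableOn_gamma_weight_mul_comp_exp hα q.continuous)] at key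
    simp only [Polynomial.eval_add, mul_add]
    refine key.congr fun k => ?_
    rw [← mul_add, ← integral_add]
    · exact integrable_continuous_comp_of_mem_Icc hX h01
        (h := fun x => x ^ k * p.eval (x ^ k)) (by fun_prop)
    · exact integrable_continuous_comp_of_mem_Icc hX h01
        (h := fun x => x ^ k * q.eval (x ^ k)) (by fun_prop)
  | monomial m a =>
    have hm : (0 : ℝ) < (m : ℝ) + 1 := by positivity
    have hsub : Tendsto (fun k : ℕ => (m + 1) * k) atTop atTop :=
      tendsto_id.const_mul_atTop' (Nat.succ_pos m)
    have key := ((hC.comp hsub).const_mul (((m : ℝ) + 1) ^ (-α))).const_mul a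
    have hlim : a * (((m : ℝ) + 1) ^ (-α) * C) = C / Real.Gamma α *
        ∫ t in Set.Ioi (0 : ℝ), Real.exp (-t) * t ^ (α - 1) *
          (Polynomial.monomial m a).eval (Real.exp (-t)) := by
      have : ∀ t : ℝ, Real.exp (-t) * t ^ (α - 1) *
          (Polynomial.monomial m a).eval (Real.exp (-t)) =
          a * (Real.exp (-t) * t ^ (α - 1) * Real.exp (-t) ^ m) := fun t => by
        rw [Polynomial.eval_monomial]; ring
      simp only [this]
      rw [integral_const_mul, integral_gamma_weight_mul_exp_pow hα]
      field_simp
    rw [← hlim]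
    refine key.congr fun k => ?_
    have : ∀ ω, X ω ^ k * (Polynomial.monomial m a).eval (X ω ^ k) = a * X ω ^ ((m + 1) * k) :=
      fun ω => by rw [Polynomial.eval_monomial]; ring
    simp only [this, Function.comp_apply]
    rw [integral_const_mul]
    push_cast
    rw [Real.mul_rpow hm.le (Nat.cast_nonneg k), Real.rpow_neg hm.le]
    have := (Real.rpow_pos_of_pos hm α).ne'
    field_simp

/-- Weierstrass approximation. The factor X ^ k kept in front of h is what makes a uniform error η
cost only η times the convergent quantity k ^ α ∫ X ^ k. -/
theorem tendsto_rpow_mul_integral_pow_mul_continuous {α C : ℝ} (hα : 0 < α) (hX : Measurable X)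
    (h01 : ∀ ω, X ω ∈ Set.Icc (0 : ℝ) 1)
    (hC : Tendsto (fun k : ℕ => (k : ℝ) ^ α * ∫ ω, X ω ^ k ∂μ) atTop (𝓝 C))
    {h : ℝ → ℝ} (hh : Continuous h) :
    Tendsto (fun k : ℕ => (k : ℝ) ^ α * ∫ ω, X ω ^ k * h (X ω ^ k) ∂μ) atTop
      (𝓝 (C / Real.Gamma α *
        ∫ t in Set.Ioi (0 : ℝ), Real.exp (-t) * t ^ (α - 1) * h (Real.exp (-t)))) := by
  have hΓ : 0 < Real.Gamma α := Real.Gamma_pos_of_pos hα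
  have hpow : ∀ (k : ℕ) ω, X ω ^ k ∈ Set.Icc (0 : ℝ) 1 := fun k ω =>
    ⟨pow_nonneg (h01 ω).1 k, pow_le_one₀ (h01 ω).1 (h01 ω).2⟩
  have hC0 : 0 ≤ C := ge_of_tendsto' hC fun k =>
    mul_nonneg (by positivity) (integral_nonneg fun ω => (hpow k ω).1)
  rw [Metric.tendsto_atTop]
  intro ε hε
  -- The three errors are η (C + 1), η / 2 and η C, with sum below η (2C + 2) = ε.
  set η : ℝ := ε / (2 * C + 2) with hη
  have hηpos : 0 < η := by positivity
  obtain ⟨p, hp⟩ := exists_polynomial_near_of_continuousOn 0 1 h hh.continuousOn η hηpos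
  have hpt := tendsto_rpow_mul_integral_pow_mul_polynomial hα hX h01 hC p
  obtain ⟨K₁, hK₁⟩ := Metric.tendsto_atTop.1 hpt (η / 2) (by positivity)
  obtain ⟨K₂, hK₂⟩ := eventually_atTop.1 (hC.eventually (gt_mem_nhds (show C < C + 1 by linarith)))
  refine ⟨max K₁ K₂, fun k hk => ?_⟩
  have e₁ := hK₁ k (le_of_max_le_left hk)
  have e₂ := hK₂ k (le_of_max_le_right hk)
  have d₁ : |((k : ℝ) ^ α * ∫ ω, X ω ^ k * h (X ω ^ k) ∂μ) -
      ((k : ℝ) ^ α * ∫ ω, X ω ^ k * p.eval (X ω ^ k) ∂μ)| ≤ η * (C + 1) := by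
    rw [← mul_sub, ← integral_sub, abs_mul, abs_of_nonneg (by positivity : (0 : ℝ) ≤ (k : ℝ) ^ α)]
    · calc _ ≤ (k : ℝ) ^ α * ∫ ω, η * X ω ^ k ∂μ := by
            gcongr
            rw [← Real.norm_eq_abs]
            refine norm_integral_le_of_norm_le
              (integrable_continuous_comp_of_mem_Icc hX h01 (h := fun x => η * x ^ k)
                (by fun_prop)) (Eventually.of_forall fun ω => ?_)
            rw [← mul_sub, Real.norm_eq_abs, abs_mul, abs_of_nonneg (hpow k ω).1, mul_comm,
              abs_sub_comm]
            exact mul_le_mul_of_nonneg_right (hp _ (hpow k ω)).le (hpow k ω).1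
        _ = η * ((k : ℝ) ^ α * ∫ ω, X ω ^ k ∂μ) := by rw [integral_const_mul]; ring
        _ ≤ η * (C + 1) := by gcongr
    · exact integrable_continuous_comp_of_mem_Icc hX h01
        (h := fun x => x ^ k * h (x ^ k)) (by fun_prop)
    · exact integrable_continuous_comp_of_mem_Icc hX h01
        (h := fun x => x ^ k * p.eval (x ^ k)) (by fun_prop)
  have d₂ : |(C / Real.Gamma α *
        ∫ t in Set.Ioi (0 : ℝ), Real.exp (-t) * t ^ (α - 1) * p.eval (Real.exp (-t))) -
      (C / Real.Gamma α *
        ∫ t in Set.Ioi (0 : ℝ), Real.exp (-t) * t ^ (α - 1) * h (Real.exp (-t)))| ≤ η * C := by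
    rw [← mul_sub, ← integral_sub (integrableOn_gamma_weight_mul_comp_exp hα p.continuous)
      (integrableOn_gamma_weight_mul_comp_exp hα hh), abs_mul, abs_of_nonneg (by positivity)]
    calc _ ≤ C / Real.Gamma α * ∫ t in Set.Ioi (0 : ℝ), Real.exp (-t) * t ^ (α - 1) * η := by
          gcongr
          rw [← Real.norm_eq_abs]
          refine norm_integral_le_of_norm_le ((Real.GammaIntegral_convergent hα).mul_const η) ?_
          refine (ae_restrict_iff' measurableSet_Ioi).2 (Eventually.of_forall fun t ht => ?_)
          have ht' : (0 : ℝ) < t := ht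
          have hw : 0 ≤ Real.exp (-t) * t ^ (α - 1) := by positivity
          rw [← mul_sub, Real.norm_eq_abs, abs_mul, abs_of_nonneg hw]
          exact mul_le_mul_of_nonneg_left (hp _ ⟨by positivity,
            Real.exp_le_one_iff.2 (by linarith)⟩).le hw
      _ = η * C := by
          rw [integral_mul_const, ← Real.Gamma_eq_integral hα]; field_simp
  rw [Real.dist_eq] at e₁ ⊢
  have hsum : η * (C + 1) + η / 2 + η * C < ε := by
    have : ε = η * (2 * C + 2) := by rw [hη]; field_simp
    nlinarith
  calc _ ≤ _ := abs_sub_le _ ((k : ℝ) ^ α * ∫ ω, X ω ^ k * p.eval (X ω ^ k) ∂μ) _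
    _ ≤ _ := add_le_add_right (abs_sub_le _ (C / Real.Gamma α *
        ∫ t in Set.Ioi (0 : ℝ), Real.exp (-t) * t ^ (α - 1) * p.eval (Real.exp (-t))) _) _
    _ < ε := by linarith

/-- A continuous function `ψ` such that `x ↦ x * ψ x` increases from `0` at `b` to `1` at `c`. -/
noncomputable def rampDiv (b c x : ℝ) : ℝ := max 0 (min 1 ((x - b) / (c - b))) / max x b

theorem continuous_rampDiv {b c : ℝ} (hb : 0 < b) : Continuous (rampDiv b c) := by
  unfold rampDiv
  refine Continuous.div (by fun_prop) (by fun_prop) fun x => ?_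
  exact (lt_of_lt_of_le hb (le_max_right x b)).ne'

/-- Below b the numerator of `rampDiv` vanishes, and from b on its denominator is x; the maximum
only avoids a pole at 0. -/
theorem mul_rampDiv_le_indicator {b c x : ℝ} (hb : 0 < b) (hbc : b < c) :
    x * rampDiv b c x ≤ Set.indicator (Set.Ici b) 1 x := by
  unfold rampDiv
  by_cases h : b ≤ x
  · rw [Set.indicator_of_mem (Set.mem_Ici.2 h), max_eq_left h,
      mul_div_cancel₀ _ (hb.trans_le h).ne']
    exact max_le zero_le_one (min_le_left _ _)
  · rw [Set.indicator_of_notMem (by simpa using h), max_eq_left (a := (0 : ℝ))]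
    · simp
    · refine (min_le_right _ _).trans (div_nonpos_of_nonpos_of_nonneg ?_ ?_) <;> linarith

theorem indicator_le_mul_rampDiv {b c x : ℝ} (hb : 0 < b) (hbc : b < c) (hx : 0 ≤ x) :
    Set.indicator (Set.Ici c) 1 x ≤ x * rampDiv b c x := by
  unfold rampDiv
  by_cases h : c ≤ x
  · rw [Set.indicator_of_mem (Set.mem_Ici.2 h), max_eq_left (hbc.le.trans h),
      mul_div_cancel₀ _ ((hb.trans hbc).trans_le h).ne', min_eq_left]
    · simp
    · rw [le_div_iff₀ (by linarith)]; linarith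
  · rw [Set.indicator_of_notMem (by simpa using h)]
    exact mul_nonneg hx (div_nonneg (le_max_left _ _) (hb.le.trans (le_max_right _ _)))

theorem integral_Ioi_indicator_rpow {α β : ℝ} (hα : 0 < α) (hβ : 0 < β) :
    ∫ t in Set.Ioi (0 : ℝ), (Set.Ioc 0 β).indicator (fun t => t ^ (α - 1)) t = β ^ α / α := by
  rw [setIntegral_indicator measurableSet_Ioc, Set.inter_eq_right.2 Set.Ioc_subset_Ioi_self,
    ← intervalIntegral.integral_of_le hβ.le, integral_rpow (Or.inl (by linarith))]
  simp [Real.zero_rpow hα.ne']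

theorem integrableOn_Ioi_indicator_rpow {α β : ℝ} (hα : 0 < α) (hβ : 0 < β) :
    IntegrableOn ((Set.Ioc 0 β).indicator (fun t : ℝ => t ^ (α - 1))) (Set.Ioi 0) := by
  rw [IntegrableOn, integrable_indicator_iff measurableSet_Ioc]
  have h := intervalIntegral.intervalIntegrable_rpow' (a := 0) (b := β)
    (show -1 < α - 1 by linarith)
  rw [intervalIntegrable_iff_integrableOn_Ioc_of_le hβ.le] at h
  exact IntegrableOn.mono_measure h Measure.restrict_le_self

/-- The weight exp(-t) is the factor x of x * `rampDiv` at x = exp(-t), so the ramp bound leaves t ^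
(α - 1) on t ≤ β. -/
theorem integral_gamma_weight_mul_rampDiv_le {α β c : ℝ} (hα : 0 < α) (hβ : 0 < β)
    (hc : Real.exp (-β) < c) :
    ∫ t in Set.Ioi (0 : ℝ), Real.exp (-t) * t ^ (α - 1) * rampDiv (Real.exp (-β)) c (Real.exp (-t)) ≤
      β ^ α / α := by
  rw [← integral_Ioi_indicator_rpow hα hβ]
  refine setIntegral_mono_on (integrableOn_gamma_weight_mul_comp_exp hα
    (continuous_rampDiv (Real.exp_pos _))) (integrableOn_Ioi_indicator_rpow hα hβ)
    measurableSet_Ioi fun t ht => ?_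
  have ht' : (0 : ℝ) < t := ht
  have h := mul_rampDiv_le_indicator (x := Real.exp (-t)) (Real.exp_pos (-β)) hc
  have hw : 0 ≤ t ^ (α - 1) := by positivity
  rw [mul_right_comm]
  refine (mul_le_mul_of_nonneg_right h hw).trans (le_of_eq ?_)
  by_cases htβ : t ≤ β
  · rw [Set.indicator_of_mem (s := Set.Ici _) (by simpa using htβ), Set.indicator_of_mem (s := Set.Ioc 0 β) (Set.mem_Ioc.2 ⟨ht', htβ⟩)]; simp
  · rw [Set.indicator_of_notMem (by simpa using htβ),
      Set.indicator_of_notMem (fun h => htβ h.2)]; simp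

theorem le_integral_gamma_weight_mul_rampDiv {α β b : ℝ} (hα : 0 < α) (hβ : 0 < β)
    (hb : 0 < b) (hbc : b < Real.exp (-β)) :
    β ^ α / α ≤
    ∫ t in Set.Ioi (0 : ℝ), Real.exp (-t) * t ^ (α - 1) * rampDiv b (Real.exp (-β)) (Real.exp (-t)) := by
  rw [← integral_Ioi_indicator_rpow hα hβ]
  refine setIntegral_mono_on (integrableOn_Ioi_indicator_rpow hα hβ)
    (integrableOn_gamma_weight_mul_comp_exp hα (continuous_rampDiv hb))
    measurableSet_Ioi fun t ht => ?_
  have ht' : (0 : ℝ) < t := ht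
  have h := indicator_le_mul_rampDiv hb hbc (Real.exp_pos (-t)).le
  have hw : 0 ≤ t ^ (α - 1) := by positivity
  rw [mul_right_comm]
  refine le_trans (le_of_eq ?_) (mul_le_mul_of_nonneg_right h hw)
  by_cases htβ : t ≤ β
  · rw [Set.indicator_of_mem (s := Set.Ici _) (by simpa using htβ),
      Set.indicator_of_mem (s := Set.Ioc 0 β) (Set.mem_Ioc.2 ⟨ht', htβ⟩)]; simp
  · rw [Set.indicator_of_notMem (s := Set.Ici _) (by simpa using htβ),
      Set.indicator_of_notMem (fun h => htβ h.2)]; simp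

/-- **Karamata's Tauberian theorem** for the moments of a random variable with values in `[0, 1]`. -/
theorem tendsto_measureReal_exp_neg_le_div_rpow {α C : ℝ} (hα : 0 < α) (hX : Measurable X)
    (h01 : ∀ ω, X ω ∈ Set.Icc (0 : ℝ) 1)
    (hC : Tendsto (fun k : ℕ => (k : ℝ) ^ α * ∫ ω, X ω ^ k ∂μ) atTop (𝓝 C)) :
    Tendsto (fun r : ℝ => μ.real {ω | Real.exp (-r) ≤ X ω} / r ^ α) (𝓝[>] 0)
      (𝓝 (C / Real.Gamma (α + 1))) := by
  have hΓ : 0 < Real.Gamma α := Real.Gamma_pos_of_pos hα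
  have hpow : ∀ (k : ℕ) ω, X ω ^ k ∈ Set.Icc (0 : ℝ) 1 := fun k ω =>
    ⟨pow_nonneg (h01 ω).1 k, pow_le_one₀ (h01 ω).1 (h01 ω).2⟩
  have hC0 : 0 ≤ C := ge_of_tendsto' hC fun k =>
    mul_nonneg (by positivity) (integral_nonneg fun ω => (hpow k ω).1)
  have hinv : Tendsto (fun r : ℝ => r⁻¹) (𝓝[>] 0) atTop := tendsto_inv_nhdsGT_zero
  -- With k = ⌈1/r⌉, the event X ≥ exp(-r) is X ^ k ≥ exp(-rk), where rk → 1: the threshold becomes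
  -- essentially the fixed number exp(-1).
  have hk : Tendsto (fun r : ℝ => ⌈r⁻¹⌉₊) (𝓝[>] 0) atTop := tendsto_nat_ceil_atTop.comp hinv
  have hrk : Tendsto (fun r : ℝ => r * ⌈r⁻¹⌉₊) (𝓝[>] 0) (𝓝 1) := by
    refine ((tendsto_nat_ceil_div_atTop (R := ℝ)).comp hinv).congr fun r => ?_
    simp [mul_comm]
  have hpos : ∀ᶠ r : ℝ in 𝓝[>] 0, 0 < r := eventually_mem_nhdsWithin
  have hset : ∀ r : ℝ, 0 < r → ∀ ω,
      Real.exp (-r) ≤ X ω ↔ Real.exp (-(r * ⌈r⁻¹⌉₊)) ≤ X ω ^ ⌈r⁻¹⌉₊ := by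
    intro r hr ω
    have hk0 : ⌈r⁻¹⌉₊ ≠ 0 := (Nat.ceil_pos.2 (inv_pos.2 hr)).ne'
    have : Real.exp (-(r * ⌈r⁻¹⌉₊)) = Real.exp (-r) ^ ⌈r⁻¹⌉₊ := by
      rw [← Real.exp_nat_mul]; congr 1; ring
    rw [this, pow_le_pow_iff_left₀ (Real.exp_pos _).le (h01 ω).1 hk0]
  have hmeas : ∀ r : ℝ, MeasurableSet {ω | Real.exp (-r) ≤ X ω} := fun r =>
    measurableSet_le measurable_const hX
  have hcont : ∀ a, ContinuousAt (fun β : ℝ => C / Real.Gamma α * (β ^ α / α)) a := fun a =>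
    ((Real.continuousAt_rpow_const a α (Or.inr hα.le)).div_const α).const_mul _
  have hone : C / Real.Gamma α * ((1 : ℝ) ^ α / α) = C / Real.Gamma (α + 1) := by
    rw [Real.Gamma_add_one hα.ne', Real.one_rpow]; field_simp
  have hG : Tendsto (fun r : ℝ => (⌈r⁻¹⌉₊ : ℝ) ^ α * μ.real {ω | Real.exp (-r) ≤ X ω}) (𝓝[>] 0)
      (𝓝 (C / Real.Gamma (α + 1))) := by
    refine tendsto_order.2 ⟨fun a ha => ?_, fun a ha => ?_⟩
    · rw [← hone] at ha
      -- By continuity in β, the bound at 1 survives at some β < 1. The ramp starts at exp(-(1 +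
      -- β)/2), strictly above exp(-1), which leaves room for rk to differ from 1.
      obtain ⟨β, ⟨hβ0, hβ1⟩, hβa⟩ : ∃ β : ℝ, β ∈ Set.Ioo 0 1 ∧
          a < C / Real.Gamma α * (β ^ α / α) :=
        (Filter.Eventually.and (Ioo_mem_nhdsLT zero_lt_one)
          (((hcont 1).tendsto.mono_left nhdsWithin_le_nhds).eventually (lt_mem_nhds ha))).exists
      have hbc : Real.exp (-((1 + β) / 2)) < Real.exp (-β) := Real.exp_lt_exp.2 (by linarith)
      have hψ := (tendsto_rpow_mul_integral_pow_mul_continuous hα hX h01 hC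
        (continuous_rampDiv (c := Real.exp (-β)) (Real.exp_pos (-((1 + β) / 2))))).comp hk
      have hlt : a < C / Real.Gamma α * ∫ t in Set.Ioi (0 : ℝ), Real.exp (-t) * t ^ (α - 1) *
          rampDiv (Real.exp (-((1 + β) / 2))) (Real.exp (-β)) (Real.exp (-t)) :=
        hβa.trans_le (mul_le_mul_of_nonneg_left
          (le_integral_gamma_weight_mul_rampDiv hα hβ0 (Real.exp_pos _) hbc) (by positivity))
      filter_upwards [hψ.eventually (lt_mem_nhds hlt), hpos,
        hrk.eventually (lt_mem_nhds (show (1 + β) / 2 < 1 by linarith))] with r h₁ hr h₂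
      refine h₁.trans_le (mul_le_mul_of_nonneg_left ?_ (by positivity))
      rw [← integral_indicator_one (hmeas r)]
      refine integral_mono (integrable_continuous_comp_of_mem_Icc hX h01
        (h := fun x => x ^ ⌈r⁻¹⌉₊ * rampDiv (Real.exp (-((1 + β) / 2))) (Real.exp (-β))
          (x ^ ⌈r⁻¹⌉₊)) ?_) ((integrable_const 1).indicator (hmeas r)) fun ω => ?_
      · have := continuous_rampDiv (c := Real.exp (-β)) (Real.exp_pos (-((1 + β) / 2)))
        fun_prop
      · refine (mul_rampDiv_le_indicator (Real.exp_pos _) hbc).trans ?_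
        by_cases hω : Real.exp (-((1 + β) / 2)) ≤ X ω ^ ⌈r⁻¹⌉₊
        · rw [Set.indicator_of_mem (Set.mem_Ici.2 hω), Set.indicator_of_mem]
          · simp
          · exact (hset r hr ω).2 ((Real.exp_le_exp.2 (by linarith)).trans hω)
        · rw [Set.indicator_of_notMem (by simpa using hω)]
          exact Set.indicator_nonneg (fun _ _ => zero_le_one) _
    · rw [← hone] at ha
      obtain ⟨β, hβ1, hβa⟩ : ∃ β : ℝ, β ∈ Set.Ioi 1 ∧
          C / Real.Gamma α * (β ^ α / α) < a :=
        ((eventually_mem_nhdsWithin : ∀ᶠ β in 𝓝[>] (1 : ℝ), β ∈ Set.Ioi 1).and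
          (((hcont 1).tendsto.mono_left nhdsWithin_le_nhds).eventually (gt_mem_nhds ha))).exists
      have hβ1 : 1 < β := hβ1
      have hbc : Real.exp (-β) < Real.exp (-((1 + β) / 2)) := Real.exp_lt_exp.2 (by linarith)
      have hψ := (tendsto_rpow_mul_integral_pow_mul_continuous hα hX h01 hC
        (continuous_rampDiv (c := Real.exp (-((1 + β) / 2))) (Real.exp_pos (-β)))).comp hk
      have hlt := (mul_le_mul_of_nonneg_left (integral_gamma_weight_mul_rampDiv_le hα
          (by linarith) hbc) (by positivity : 0 ≤ C / Real.Gamma α)).trans_lt hβa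
      filter_upwards [hψ.eventually (gt_mem_nhds hlt), hpos,
        hrk.eventually (gt_mem_nhds (show 1 < (1 + β) / 2 by linarith))] with r h₁ hr h₂
      refine lt_of_le_of_lt (mul_le_mul_of_nonneg_left ?_ (by positivity)) h₁
      rw [← integral_indicator_one (hmeas r)]
      refine integral_mono ((integrable_const 1).indicator (hmeas r))
        (integrable_continuous_comp_of_mem_Icc hX h01
        (h := fun x => x ^ ⌈r⁻¹⌉₊ * rampDiv (Real.exp (-β)) (Real.exp (-((1 + β) / 2)))
          (x ^ ⌈r⁻¹⌉₊)) ?_) fun ω => ?_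
      · have := continuous_rampDiv (c := Real.exp (-((1 + β) / 2))) (Real.exp_pos (-β))
        fun_prop
      · refine le_trans ?_ (indicator_le_mul_rampDiv (Real.exp_pos _) hbc (hpow _ ω).1)
        by_cases hω : Real.exp (-r) ≤ X ω
        · rw [Set.indicator_of_mem (s := {ω | Real.exp (-r) ≤ X ω}) hω,
            Set.indicator_of_mem (s := Set.Ici _)]
          · simp
          · exact (Real.exp_le_exp.2 (by linarith)).trans ((hset r hr ω).1 hω)
        · rw [Set.indicator_of_notMem (s := {ω | Real.exp (-r) ≤ X ω}) hω]
          exact Set.indicator_nonneg (fun _ _ => zero_le_one) _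
  have hden : Tendsto (fun r : ℝ => (r * ⌈r⁻¹⌉₊) ^ α) (𝓝[>] 0) (𝓝 1) := by
    have := hrk.rpow_const (p := α) (Or.inr hα.le)
    rwa [Real.one_rpow] at this
  have := hG.div hden one_ne_zero
  rw [div_one] at this
  refine this.congr' ?_
  filter_upwards [hpos] with r hr
  have hk0 : (0 : ℝ) < ⌈r⁻¹⌉₊ := Nat.cast_pos.2 (Nat.ceil_pos.2 (inv_pos.2 hr))
  simp only [Pi.div_apply]
  rw [Real.mul_rpow hr.le hk0.le]
  have h1 := (Real.rpow_pos_of_pos hr α).ne'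
  have h2 := (Real.rpow_pos_of_pos hk0 α).ne'
  field_simp

end Tauberian

/-! ### Compactness of U(n), unitaries used as translations, and a Vandermonde sum. -/

section UnitaryTopology

theorem compactSpace_unitaryGroup (n : ℕ) : CompactSpace (Matrix.unitaryGroup (Fin n) ℂ) := by
  have hK : IsCompact {M : Matrix (Fin n) (Fin n) ℂ | ∀ i j, M i j ∈ Metric.closedBall (0 : ℂ) 1} := by
    have := isCompact_univ_pi fun _ : Fin n => isCompact_univ_pi fun _ : Fin n =>
      isCompact_closedBall (0 : ℂ) 1
    refine (congrArg (IsCompact (X := Matrix (Fin n) (Fin n) ℂ)) (Set.ext fun M => ?_)).mpr this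
    exact ⟨fun h i _ j _ => h i j, fun h i j => h i trivial j trivial⟩
  have hcl : IsClosed {M : Matrix (Fin n) (Fin n) ℂ | M ∈ Matrix.unitaryGroup (Fin n) ℂ} := by
    simp only [Matrix.mem_unitaryGroup_iff]
    exact isClosed_eq (by fun_prop) continuous_const
  refine isCompact_iff_compactSpace.1 (hK.of_isClosed_subset hcl fun M hM i j => ?_)
  simpa using entry_norm_bound_of_unitary hM i j

theorem secondCountableTopology_unitaryGroup (n : ℕ) :
    SecondCountableTopology (Matrix.unitaryGroup (Fin n) ℂ) :=
  have : SecondCountableTopology (Matrix (Fin n) (Fin n) ℂ) :=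
    inferInstanceAs (SecondCountableTopology (Fin n → Fin n → ℂ))
  TopologicalSpace.Subtype.secondCountableTopology _

attribute [local instance] compactSpace_unitaryGroup secondCountableTopology_unitaryGroup

theorem continuous_unitaryGroup_apply {n : ℕ} (i j : Fin n) :
    Continuous fun U : Matrix.unitaryGroup (Fin n) ℂ => U.1 i j :=
  continuous_subtype_val.matrix_elem i j

theorem exists_unitary_row_zero {n : ℕ} (w : EuclideanSpace ℂ (Fin (n + 1))) (hw : ‖w‖ = 1) :
    ∃ V : Matrix.unitaryGroup (Fin (n + 1)) ℂ, ∀ l, V.1 0 l = star (w l) := by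
  obtain ⟨b, hb⟩ := Orthonormal.exists_orthonormalBasis_extension_of_card_eq (𝕜 := ℂ)
    (E := EuclideanSpace ℂ (Fin (n + 1))) (ι := Fin (n + 1)) (by simp) (v := fun _ => w) (s := {0})
    (by
      refine ⟨fun i => hw, fun i j hij => (hij (Subsingleton.elim _ _)).elim⟩)
  -- The basis vectors are columns of the change of basis matrix; the star makes the first one a
  -- conjugated row.
  refine ⟨star ⟨_, (EuclideanSpace.basisFun (Fin (n + 1)) ℂ).toMatrix_orthonormalBasis_mem_unitary b⟩,
    fun l => ?_⟩
  have := hb 0 rfl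
  simp [Matrix.star_apply, Module.Basis.toMatrix_apply, this]

theorem exists_unitary_diagonal {n : ℕ} {j : Fin (n + 1)} (hj : j ≠ 0) {ζ : ℂ} (hζ : ‖ζ‖ = 1) :
    ∃ V : Matrix.unitaryGroup (Fin (n + 1)) ℂ, ∀ U : Matrix.unitaryGroup (Fin (n + 1)) ℂ,
      (V * U).1 0 0 = U.1 0 0 ∧ (V * U).1 j 0 = ζ * U.1 j 0 := by
  refine ⟨⟨Matrix.diagonal (Function.update 1 j ζ), ?_⟩, fun U => ⟨?_, ?_⟩⟩
  · rw [Matrix.mem_unitaryGroup_iff, Matrix.star_eq_conjTranspose, Matrix.diagonal_conjTranspose,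
      Matrix.diagonal_mul_diagonal, ← Matrix.diagonal_one]
    congr 1
    funext l
    by_cases hl : l = j
    · subst hl
      simp only [Function.update_self, Pi.star_apply]
      exact (Complex.mul_conj' ζ).trans (by rw [hζ]; simp)
    · simp [hl]
  · change (Matrix.diagonal (Function.update (1 : Fin (n + 1) → ℂ) j ζ) * U.1) 0 0 = _
    simp [Matrix.diagonal_mul, hj.symm]
  · change (Matrix.diagonal (Function.update (1 : Fin (n + 1) → ℂ) j ζ) * U.1) j 0 = _
    simp [Matrix.diagonal_mul]

theorem unitary_col_norm_sq_sum {m : ℕ} (U : Matrix.unitaryGroup (Fin m) ℂ) (i : Fin m) :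
    ∑ j, ‖U.1 j i‖ ^ 2 = 1 := by
  have h := congrFun (congrFun (Matrix.mem_unitaryGroup_iff'.1 U.2) i) i
  rw [Matrix.mul_apply, Matrix.one_apply_eq] at h
  have h2 : ∀ j, (star U.1) i j * U.1 j i = ((‖U.1 j i‖ ^ 2 : ℝ) : ℂ) := fun j => by
    rw [Matrix.star_apply, mul_comm]; push_cast; exact Complex.mul_conj' _
  simp only [h2] at h
  exact_mod_cast h

/-- Each summand is a constant times C(k, m) C(k + n, k - m), so this is Vandermonde's identity for
C(2k + n, k). -/
theorem sum_choose_sq_mul_factorial_div (n k : ℕ) :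
    ∑ m ∈ Finset.range (k + 1), (k.choose m : ℝ) ^ 2 * ((m ! : ℝ) * n ! / (n + m)!) =
      ((2 * k + n)! : ℝ) * n ! / ((k + n)! : ℝ) ^ 2 := by
  have hV := Nat.add_choose_eq k (k + n) k
  rw [Finset.Nat.sum_antidiagonal_eq_sum_range_succ_mk] at hV
  have hterm : ∀ m ∈ Finset.range (k + 1), (k.choose m : ℝ) ^ 2 * ((m ! : ℝ) * n ! / (n + m)!) =
      (k ! : ℝ) * n ! / (k + n)! * ((k.choose m * (k + n).choose (k - m) : ℕ) : ℝ) := by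
    intro m hm
    have hmk : m ≤ k := Nat.lt_succ_iff.1 (Finset.mem_range.1 hm)
    push_cast
    rw [Nat.cast_choose ℝ hmk, Nat.cast_choose ℝ (show k - m ≤ k + n by omega),
      show k + n - (k - m) = n + m by omega]
    field_simp
  rw [Finset.sum_congr rfl hterm, ← Finset.mul_sum, ← Nat.cast_sum, ← hV,
    Nat.cast_choose ℝ (show k ≤ k + (k + n) by omega), show k + (k + n) - k = k + n by omega,
    show k + (k + n) = 2 * k + n by ring]
  field_simp

end UnitaryTopology

/-! ### Moments of a sum under phase invariance. -/

section Phase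

variable {G : Type*} [TopologicalSpace G] [CompactSpace G] [MeasurableSpace G] [BorelSpace G]

theorem Continuous.integrable_of_compactSpace {μ : Measure G} [IsFiniteMeasure μ]
    {E : Type*} [NormedAddCommGroup E] [SecondCountableTopologyEither G E] {f : G → E} (hf : Continuous f) : Integrable f μ :=
  hf.integrable_of_hasCompactSupport (HasCompactSupport.of_compactSpace f)

/-- Expanding (f + g)^k times its conjugate, translation by v multiplies the (i, j) term by ζ^i
times the conjugate of ζ^j, so by invariance only the diagonal terms survive. -/
theorem integral_norm_add_pow_of_phase_invariant [Group G] [MeasurableMul G] (μ : Measure G)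
    [IsFiniteMeasure μ] [μ.IsMulLeftInvariant] {f g : G → ℂ} (hf : Continuous f)
    (hg : Continuous g)
    (hphase : ∀ ζ : ℂ, ‖ζ‖ = 1 → ∃ v : G, ∀ x, f (v * x) = f x ∧ g (v * x) = ζ * g x) (k : ℕ) :
    ∫ x, ‖f x + g x‖ ^ (2 * k) ∂μ =
      ∑ m ∈ Finset.range (k + 1), (k.choose m : ℝ) ^ 2 *
        ∫ x, ‖f x‖ ^ (2 * (k - m)) * ‖g x‖ ^ (2 * m) ∂μ := by
  have hnorm : ∀ (z : ℂ) (m : ℕ), ((‖z‖ ^ (2 * m) : ℝ) : ℂ) = z ^ m * star z ^ m := fun z m => by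
    rw [← mul_pow, pow_mul]; push_cast; rw [← Complex.mul_conj']; rfl
  set Φ : ℕ → ℕ → G → ℂ := fun i j x =>
    (g x ^ i * f x ^ (k - i)) * (star (g x) ^ j * star (f x) ^ (k - j)) with hΦ
  have hΦc : ∀ i j, Continuous (Φ i j) := fun i j => by fun_prop
  have hcross : ∀ i ∈ Finset.range (k + 1), ∀ j ∈ Finset.range (k + 1), i ≠ j →
      ∫ x, Φ i j x ∂μ = 0 := by
    intro i hi j hj hij
    -- A primitive root of order k + 1 separates all exponents 0, ..., k at once.
    have hprim := Complex.isPrimitiveRoot_exp (k + 1) (Nat.succ_ne_zero k)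
    set ζ := Complex.exp (2 * Real.pi * Complex.I / ((k + 1 : ℕ) : ℂ)) with hζ
    have hζ1 : ‖ζ‖ = 1 := hprim.norm'_eq_one (Nat.succ_ne_zero k)
    have hζ0 : ζ ≠ 0 := fun h => by simp [h] at hζ1
    obtain ⟨v, hv⟩ := hphase ζ hζ1
    have hinv := integral_mul_left_eq_self (μ := μ) (Φ i j) v
    have hmul : ∀ x, Φ i j (v * x) = ζ ^ i * star ζ ^ j * Φ i j x := fun x => by
      simp only [hΦ, (hv x).1, (hv x).2, star_mul']; ring
    simp only [hmul] at hinv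
    rw [integral_const_mul] at hinv
    by_contra hne
    have h1 : ζ ^ i * star ζ ^ j = 1 := by
      apply mul_right_cancel₀ hne; rw [hinv, one_mul]
    have hstar : star ζ * ζ = 1 := by
      rw [mul_comm]; exact (Complex.mul_conj' ζ).trans (by rw [hζ1]; simp)
    have : ζ ^ i = ζ ^ j := by
      calc ζ ^ i = ζ ^ i * (star ζ * ζ) ^ j := by rw [hstar]; simp
        _ = (ζ ^ i * star ζ ^ j) * ζ ^ j := by rw [mul_pow]; ring
        _ = ζ ^ j := by rw [h1, one_mul]
    exact hij (hprim.pow_inj (Finset.mem_range.1 hi) (Finset.mem_range.1 hj) this)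
  have hexp : ∀ x, ((‖f x + g x‖ ^ (2 * k) : ℝ) : ℂ) =
      ∑ i ∈ Finset.range (k + 1), ∑ j ∈ Finset.range (k + 1),
        ((k.choose i : ℂ) * (k.choose j : ℂ)) * Φ i j x := by
    intro x
    rw [hnorm, star_add, add_comm (f x), add_comm (star (f x)), add_pow, add_pow,
      Finset.sum_mul_sum]
    refine Finset.sum_congr rfl fun i _ => Finset.sum_congr rfl fun j _ => ?_
    simp only [hΦ]; ring
  apply Complex.ofReal_injective
  rw [← integral_complex_ofReal]
  simp only [hexp]
  rw [integral_finsetSum _ fun i _ => integrable_finsetSum _ fun j _ =>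
    ((hΦc i j).integrable_of_compactSpace.const_mul _)]
  push_cast
  refine Finset.sum_congr rfl fun i hi => ?_
  rw [integral_finsetSum _ fun j _ => ((hΦc i j).integrable_of_compactSpace.const_mul _),
    Finset.sum_eq_single_of_mem i hi]
  · rw [integral_const_mul, ← integral_complex_ofReal, sq]
    congr 2
    funext x
    rw [Complex.ofReal_mul, hnorm, hnorm]
    simp only [hΦ]; ring
  · intro j hj hji
    rw [integral_const_mul, hcross i hi j hj hji.symm, mul_zero]

end Phase

/-! ### Moments of one entry of a Haar unitary. -/

section EntryMoments

attribute [local instance] compactSpace_unitaryGroup secondCountableTopology_unitaryGroup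

variable {n : ℕ} [MeasurableSpace (Matrix.unitaryGroup (Fin (n + 1)) ℂ)]
  [BorelSpace (Matrix.unitaryGroup (Fin (n + 1)) ℂ)]
  (σ : Measure (Matrix.unitaryGroup (Fin (n + 1)) ℂ)) [σ.IsMulLeftInvariant]

/-- A unitary V with first row (e₀ + t eⱼ)/√(1 + t²) turns the corner entry of VU into (U₀₀ + t
Uⱼ₀)/√(1 + t²); left invariance does the rest. -/
theorem integral_norm_add_mul_entry_pow {j : Fin (n + 1)} (hj : j ≠ 0) (t : ℝ) (k : ℕ) :
    ∫ U, ‖U.1 0 0 + t * U.1 j 0‖ ^ (2 * k) ∂σ = (1 + t ^ 2) ^ k * ∫ U, ‖U.1 0 0‖ ^ (2 * k) ∂σ := by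
  have hs : 0 < 1 + t ^ 2 := by positivity
  set c : ℝ := √(1 + t ^ 2) with hc
  have hc0 : 0 < c := Real.sqrt_pos.2 hs
  have hc2 : c ^ 2 = 1 + t ^ 2 := Real.sq_sqrt hs.le
  set w : EuclideanSpace ℂ (Fin (n + 1)) :=
    (c⁻¹ : ℂ) • (EuclideanSpace.single 0 1 + EuclideanSpace.single j (t : ℂ)) with hw
  have hwn : ‖w‖ = 1 := by
    have hin : ‖(EuclideanSpace.single 0 1 + EuclideanSpace.single j (t : ℂ) :
        EuclideanSpace ℂ (Fin (n + 1)))‖ ^ 2 = c ^ 2 := by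
      rw [@norm_add_sq ℂ, EuclideanSpace.inner_single_left]
      simp [hc2, hj.symm]
    rw [hw, norm_smul, (pow_left_inj₀ (norm_nonneg _) hc0.le two_ne_zero).1 hin, norm_inv,
      Complex.norm_real, Real.norm_of_nonneg hc0.le, inv_mul_cancel₀ hc0.ne']
  obtain ⟨V, hV⟩ := exists_unitary_row_zero w hwn
  have hentry : ∀ U : Matrix.unitaryGroup (Fin (n + 1)) ℂ,
      (V * U).1 0 0 = (c⁻¹ : ℂ) * (U.1 0 0 + t * U.1 j 0) := by
    intro U
    have hVl : ∀ l, V.1 0 l =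
        (c⁻¹ : ℂ) * ((if l = 0 then 1 else 0) + (if l = j then (t : ℂ) else 0)) := by
      intro l
      rw [hV]
      simp only [hw, PiLp.smul_apply, PiLp.add_apply, PiLp.single_apply]
      split_ifs <;> simp
    change (V.1 * U.1) 0 0 = _
    rw [Matrix.mul_apply]
    simp only [hVl, mul_assoc, add_mul, ite_mul, one_mul, zero_mul]
    simp [← Finset.mul_sum, Finset.sum_add_distrib]
  have hinv := integral_mul_left_eq_self (μ := σ) (fun U => ‖U.1 0 0‖ ^ (2 * k)) V
  rw [← hinv, ← integral_const_mul]
  refine integral_congr_ae (Eventually.of_forall fun U => ?_)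
  simp only [hentry]
  rw [norm_mul, mul_pow, norm_inv, Complex.norm_real, Real.norm_of_nonneg hc0.le, ← hc2, ← pow_mul,
    ← mul_assoc, ← mul_pow, mul_inv_cancel₀ hc0.ne', one_pow, one_mul]

variable [IsProbabilityMeasure σ]

/-- Two evaluations of ∫ |U₀₀ + t Uⱼ₀|^(2(k+1)), by phase and by rotation invariance, are
polynomials in t². Their linear coefficients are (k + 1)² times the mixed moment and (k + 1) times
the pure one. -/
theorem mul_integral_norm_entry_pow_mul_norm_entry_sq {j : Fin (n + 1)} (hj : j ≠ 0) (k : ℕ) :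
    ((k : ℝ) + 1) * ∫ U, ‖U.1 0 0‖ ^ (2 * k) * ‖U.1 j 0‖ ^ 2 ∂σ =
      ∫ U, ‖U.1 0 0‖ ^ (2 * (k + 1)) ∂σ := by
  set A : ℕ → ℝ := fun m => ∫ U, ‖U.1 0 0‖ ^ (2 * (k + 1 - m)) * ‖U.1 j 0‖ ^ (2 * m) ∂σ with hA
  set M : ℝ := ∫ U, ‖U.1 0 0‖ ^ (2 * (k + 1)) ∂σ with hM
  have hid : ∀ t : ℝ, ∑ m ∈ Finset.range (k + 1 + 1), ((k + 1).choose m : ℝ) ^ 2 * A m * (t ^ 2) ^ m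
      = M * (1 + t ^ 2) ^ (k + 1) := by
    intro t
    have h1 := integral_norm_add_mul_entry_pow σ hj t (k + 1)
    rw [integral_norm_add_pow_of_phase_invariant σ (f := fun U => U.1 0 0)
      (g := fun U => t * U.1 j 0) (continuous_unitaryGroup_apply 0 0)
      (continuous_const.mul (continuous_unitaryGroup_apply j 0)) ?_ (k + 1)] at h1
    · rw [mul_comm M, ← h1]
      refine Finset.sum_congr rfl fun m _ => ?_
      rw [mul_assoc, hA]
      congr 1
      simp only [← integral_mul_const]
      refine integral_congr_ae (Eventually.of_forall fun U => ?_)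
      simp only [norm_mul, Complex.norm_real, mul_pow, pow_mul, Real.norm_eq_abs, sq_abs]
      ring
    · intro ζ hζ
      obtain ⟨V, hV⟩ := exists_unitary_diagonal hj hζ
      exact ⟨V, fun U => ⟨(hV U).1, by rw [(hV U).2]; ring⟩⟩
  have hpoly : ∑ m ∈ Finset.range (k + 1 + 1),
        Polynomial.C (((k + 1).choose m : ℝ) ^ 2 * A m) * Polynomial.X ^ m =
      Polynomial.C M * (1 + Polynomial.X) ^ (k + 1) := by
    -- Every s ≥ 0 is a square t², which gives infinitely many points of agreement.
    refine Polynomial.eq_of_infinite_eval_eq _ _ ((Set.Ici_infinite (0 : ℝ)).mono fun s hs => ?_)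
    have hs' : 0 ≤ s := hs
    have := hid (√s)
    rw [Real.sq_sqrt hs'] at this
    simpa [Polynomial.eval_finsetSum] using this
  have hcoeff := congrArg (fun p => Polynomial.coeff p 1) hpoly
  simp only [Polynomial.finsetSum_coeff, Polynomial.coeff_C_mul, Polynomial.coeff_X_pow,
    Polynomial.coeff_one_add_X_pow] at hcoeff
  rw [Finset.sum_eq_single_of_mem 1 (by simp) (fun m _ hm => by simp [hm.symm])] at hcoeff
  have hk : ((k : ℝ) + 1) ≠ 0 := by positivity
  simp only [hA, Nat.choose_one_right, add_tsub_cancel_right, mul_one, if_true] at hcoeff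
  push_cast at hcoeff
  apply mul_left_cancel₀ hk
  linear_combination hcoeff

/-- Insert ∑ⱼ |Uⱼ₀|² = 1 into the k-th moment: each of the n mixed terms is a multiple of the next
moment. -/
theorem integral_norm_entry_pow_succ (k : ℕ) :
    ((k : ℝ) + 1 + n) * ∫ U, ‖U.1 0 0‖ ^ (2 * (k + 1)) ∂σ =
      ((k : ℝ) + 1) * ∫ U, ‖U.1 0 0‖ ^ (2 * k) ∂σ := by
  have hsum : ∀ U : Matrix.unitaryGroup (Fin (n + 1)) ℂ,
      ‖U.1 0 0‖ ^ (2 * k) = ‖U.1 0 0‖ ^ (2 * (k + 1)) +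
        ∑ j : Fin n, ‖U.1 0 0‖ ^ (2 * k) * ‖U.1 j.succ 0‖ ^ 2 := fun U => by
    have := unitary_col_norm_sq_sum U 0
    rw [Fin.sum_univ_succ] at this
    rw [← Finset.mul_sum, eq_sub_iff_add_eq'.2 this]; ring
  have hc := fun i : Fin (n + 1) => continuous_unitaryGroup_apply (n := n + 1) i 0
  have h2 : ∫ U, ‖U.1 0 0‖ ^ (2 * k) ∂σ = ∫ U, ‖U.1 0 0‖ ^ (2 * (k + 1)) ∂σ +
      ∑ j : Fin n, ∫ U, ‖U.1 0 0‖ ^ (2 * k) * ‖U.1 j.succ 0‖ ^ 2 ∂σ := by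
    rw [← integral_finsetSum, ← integral_add]
    · exact integral_congr_ae (Eventually.of_forall hsum)
    · exact ((hc 0).norm.pow _).integrable_of_compactSpace
    · exact (continuous_finsetSum _ fun j _ =>
        ((hc 0).norm.pow _).mul ((hc j.succ).norm.pow _)).integrable_of_compactSpace
    · exact fun j _ => (((hc 0).norm.pow _).mul ((hc j.succ).norm.pow _)).integrable_of_compactSpace
  rw [h2, mul_add (_ + 1 : ℝ), Finset.mul_sum]
  simp only [mul_integral_norm_entry_pow_mul_norm_entry_sq σ (Fin.succ_ne_zero _) k]
  simp; ring

theorem integral_norm_entry_pow (k : ℕ) :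
    ∫ U, ‖U.1 0 0‖ ^ (2 * k) ∂σ = (k ! : ℝ) * n ! / (n + k)! := by
  induction k with
  | zero =>
    have : (n ! : ℝ) ≠ 0 := by positivity
    simp [this]
  | succ k ih =>
    have h := integral_norm_entry_pow_succ σ k
    rw [ih] at h
    have h1 : ((k : ℝ) + 1 + n) ≠ 0 := by positivity
    apply mul_left_cancel₀ h1
    rw [h, Nat.factorial_succ k, ← add_assoc, Nat.factorial_succ (n + k)]
    push_cast
    field_simp
    ring

/-- Scalar unitaries ζ • 1 supply the phases, with the constant 1 as fixed summand; the Vandermonde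
sum then closes the formula. -/
theorem integral_norm_one_add_entry_pow (k : ℕ) :
    ∫ U, ‖1 + U.1 0 0‖ ^ (2 * k) ∂σ = ((2 * k + n)! : ℝ) * n ! / ((k + n)! : ℝ) ^ 2 := by
  rw [integral_norm_add_pow_of_phase_invariant σ (f := fun _ => 1) (g := fun U => U.1 0 0)
      continuous_const (continuous_unitaryGroup_apply 0 0) ?_ k, ← sum_choose_sq_mul_factorial_div]
  · simp [integral_norm_entry_pow]
  · intro ζ hζ
    refine ⟨⟨ζ • 1, ?_⟩, fun U => ⟨rfl, ?_⟩⟩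
    · rw [Matrix.mem_unitaryGroup_iff]
      simp only [star_smul, star_one, smul_mul_smul_comm, mul_one]
      rw [show ζ * star ζ = 1 from (Complex.mul_conj' ζ).trans (by rw [hζ]; simp), one_smul]
    · change ((ζ • (1 : Matrix (Fin (n + 1)) (Fin (n + 1)) ℂ)) * U.1) 0 0 = _
      simp

end EntryMoments

/-! ### Decorrelation by equivariance. -/

section Independence

theorem isMulLeftInvariant_map_of_equivariant {G H : Type*} [Group G] [MeasurableSpace G]
    [MeasurableMul G] [Group H] [MeasurableSpace H] [MeasurableMul H]
    (σ : Measure G) [σ.IsMulLeftInvariant] {ρ : G → H}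
    (hρ : Measurable ρ) {ι : H → G} (hι : ∀ h x, ρ (ι h * x) = h * ρ x) :
    (σ.map ρ).IsMulLeftInvariant := ⟨fun h => by
  have hcomp : (fun y => h * y) ∘ ρ = ρ ∘ fun x => ι h * x := funext fun x => (hι h x).symm
  rw [Measure.map_map (measurable_const_mul h) hρ, hcomp,
    ← Measure.map_map hρ (measurable_const_mul (ι h)), map_mul_left_eq_self]⟩

/-- If `ρ : G → H` intertwines left translations along `ι : H → G`, and `f` is invariant under
`ι`, then `f` and `ρ` are uncorrelated for a left invariant probability measure. -/
theorem integral_mul_comp_eq_of_equivariant {G H : Type*} [Group G] [MeasurableSpace G]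
    [MeasurableMul G] [Group H] [MeasurableSpace H] [MeasurableMul₂ H] [MeasurableInv H]
    (σ : Measure G) [IsProbabilityMeasure σ] [σ.IsMulLeftInvariant] {ρ : G → H}
    (hρ : Measurable ρ) {ι : H → G} (hι : ∀ h x, ρ (ι h * x) = h * ρ x) {f : G → ℝ}
    (hf : Measurable f) (hfι : ∀ h x, f (ι h * x) = f x) {A : ℝ} (hfA : ∀ x, ‖f x‖ ≤ A)
    {g : H → ℝ} (hg : Measurable g) {B : ℝ} (hgB : ∀ x, ‖g x‖ ≤ B) :
    ∫ x, f x * g (ρ x) ∂σ = (∫ x, f x ∂σ) * ∫ y, g y ∂(σ.map ρ) := by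
  have hprob : IsProbabilityMeasure (σ.map ρ) := Measure.isProbabilityMeasure_map hρ.aemeasurable
  have hinv := isMulLeftInvariant_map_of_equivariant σ hρ hι
  -- Translate x by ι h⁻¹, average over h with the law of ρ, and exchange integrals: by invariance
  -- of that law the inner integral no longer depends on x.
  have key : ∀ f : G → ℝ, Measurable f → (∀ h x, f (ι h * x) = f x) → (∃ A, ∀ x, ‖f x‖ ≤ A) →
      ∫ x, f x * g (ρ x) ∂σ = (∫ x, f x ∂σ) * ∫ h, g h⁻¹ ∂(σ.map ρ) := by
    rintro f hf hfι ⟨A, hfA⟩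
    have h1 : ∀ h : H, ∫ x, f x * g (h⁻¹ * ρ x) ∂σ = ∫ x, f x * g (ρ x) ∂σ := fun h => by
      rw [← integral_mul_left_eq_self (μ := σ) (fun x => f x * g (ρ x)) (ι h⁻¹)]
      simp only [hι, hfι]
    have h2 : ∀ x : G, ∫ h, f x * g (h⁻¹ * ρ x) ∂(σ.map ρ) = f x * ∫ h, g h⁻¹ ∂(σ.map ρ) := fun x => by
      rw [integral_const_mul,
        ← integral_mul_left_eq_self (μ := σ.map ρ) (fun h => g h⁻¹) (ρ x)⁻¹]
      simp
    calc ∫ x, f x * g (ρ x) ∂σ = ∫ _h, (∫ x, f x * g (ρ x) ∂σ) ∂(σ.map ρ) := by simp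
      _ = ∫ h, (∫ x, f x * g (h⁻¹ * ρ x) ∂σ) ∂(σ.map ρ) := by simp only [h1]
      _ = ∫ x, (∫ h, f x * g (h⁻¹ * ρ x) ∂(σ.map ρ)) ∂σ := by
          refine integral_integral_swap (Integrable.of_bound ?_ (A * B)
            (Eventually.of_forall fun z => ?_))
          · refine Measurable.aestronglyMeasurable ?_
            exact (hf.comp measurable_snd).mul
              (hg.comp (measurable_fst.inv.mul (hρ.comp measurable_snd)))
          · rw [Function.uncurry_def, norm_mul]
            exact mul_le_mul (hfA _) (hgB _) (norm_nonneg _) ((norm_nonneg _).trans (hfA z.2))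
      _ = _ := by simp only [h2]; rw [integral_mul_const]
  -- The case f = 1 identifies the integral of g h⁻¹ with that of g.
  have h1 := key (fun _ => 1) measurable_const (fun _ _ => rfl) ⟨1, by simp⟩
  simp only [one_mul, integral_const, probReal_univ, smul_eq_mul, mul_one] at h1
  rw [key f hf hfι ⟨A, hfA⟩, ← h1, integral_map hρ.aemeasurable hg.aestronglyMeasurable]

end Independence

/-! ### Reduction from U(n + 1) to U(n) and the moments of det(1 + U). -/

section Reduction

attribute [local instance] compactSpace_unitaryGroup secondCountableTopology_unitaryGroup

variable {n : ℕ}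

theorem unitary_star_mul_apply {m : ℕ} (U : Matrix.unitaryGroup (Fin m) ℂ) (i j : Fin m) :
    ∑ l, star (U.1 l i) * U.1 l j = if i = j then 1 else 0 := by
  have h := congrFun (congrFun (Matrix.mem_unitaryGroup_iff'.1 U.2) i) j
  rw [Matrix.mul_apply, Matrix.one_apply] at h
  exact h

theorem unitary_row_zero_of_one_add_eq_zero (U : Matrix.unitaryGroup (Fin (n + 1)) ℂ)
    (h : 1 + U.1 0 0 = 0) (j : Fin n) : U.1 0 j.succ = 0 := by
  have hs := unitary_col_norm_sq_sum (star U) 0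
  have hst : ∀ l, ‖(star U).1 l 0‖ = ‖U.1 0 l‖ := fun l => by
    change ‖star (U.1 0 l)‖ = _
    exact norm_star _
  simp only [hst] at hs
  rw [Fin.sum_univ_succ, ← neg_eq_of_add_eq_zero_right h] at hs
  simp only [norm_neg, norm_one, one_pow, add_eq_left] at hs
  have := (Finset.sum_eq_zero_iff_of_nonneg fun l _ => by positivity).1 hs j (Finset.mem_univ j)
  simpa using this

/-- The coefficient `z` such that adding `z` times the column `0` to the column `j + 1` of `1 + U`
clears its first entry. -/
noncomputable def clearCoeff (U : Matrix.unitaryGroup (Fin (n + 1)) ℂ) (j : Fin n) : ℂ :=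
  -(U.1 0 j.succ / (1 + U.1 0 0))

/-- The degenerate case U₀₀ = -1 is harmless: the first row is a unit vector, so its other entries
vanish and both sides are 0. -/
theorem row_zero_eq_neg_mul_clearCoeff (U : Matrix.unitaryGroup (Fin (n + 1)) ℂ) (j : Fin n) :
    U.1 0 j.succ = -((1 + U.1 0 0) * clearCoeff U j) := by
  by_cases h : 1 + U.1 0 0 = 0
  · rw [unitary_row_zero_of_one_add_eq_zero U h, h]; simp
  · unfold clearCoeff; field_simp

/-- The Schur complement of the corner entry of `1 + U`, minus the identity. -/
noncomputable def schurReduce (U : Matrix.unitaryGroup (Fin (n + 1)) ℂ) :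
    Matrix.unitaryGroup (Fin n) ℂ :=
  ⟨Matrix.of fun i j => U.1 i.succ j.succ + U.1 i.succ 0 * clearCoeff U j, by
    rw [Matrix.mem_unitaryGroup_iff']
    ext i j
    rw [Matrix.mul_apply, Matrix.one_apply]
    set z := clearCoeff U with hz
    -- The columns U_{j+1} + z_j U_0 have Gram matrix δ_ij + conj(z_i) z_j by orthonormality. Their
    -- top entries are -z_j, so deleting the top row removes exactly conj(z_i) z_j.
    have hW0 : ∀ j, U.1 0 (Fin.succ j) + U.1 0 0 * z j = -z j := fun j => by
      rw [row_zero_eq_neg_mul_clearCoeff]; ring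
    have hsum : ∑ l, star (U.1 l i.succ + U.1 l 0 * z i) * (U.1 l j.succ + U.1 l 0 * z j) =
        (if i = j then 1 else 0) + star (z i) * z j := by
      have h1 := unitary_star_mul_apply U i.succ j.succ
      have h2 := unitary_star_mul_apply U i.succ 0
      have h3 := unitary_star_mul_apply U 0 j.succ
      have h4 := unitary_star_mul_apply U 0 0
      simp only [Fin.succ_inj, Fin.succ_ne_zero, (Fin.succ_ne_zero j).symm, if_false, if_true]
        at h1 h2 h3 h4
      calc _ = ∑ l, (star (U.1 l i.succ) * U.1 l j.succ + star (U.1 l i.succ) * U.1 l 0 * z j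
            + star (z i) * (star (U.1 l 0) * U.1 l j.succ)
            + star (z i) * z j * (star (U.1 l 0) * U.1 l 0)) :=
            Finset.sum_congr rfl fun l _ => by simp only [star_add, star_mul']; ring
        _ = _ := by
            simp only [Finset.sum_add_distrib, ← Finset.mul_sum, ← Finset.sum_mul, h1, h2, h3, h4]
            ring
    rw [Fin.sum_univ_succ, hW0, hW0] at hsum
    simp only [Matrix.star_apply, Matrix.of_apply]
    rw [star_neg] at hsum
    linear_combination hsum⟩

/-- Adding multiples of column 0 keeps the determinant and clears the first row beyond the corner;
the remaining block is 1 + `schurReduce U`. -/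
theorem det_one_add_eq_mul_det_schurReduce (U : Matrix.unitaryGroup (Fin (n + 1)) ℂ) :
    (1 + U.1).det = (1 + U.1 0 0) * (1 + (schurReduce U).1).det := by
  set B : Matrix (Fin (n + 1)) (Fin (n + 1)) ℂ := Matrix.of fun i j =>
    (1 + U.1) i j + Fin.cases 0 (clearCoeff U) j * (1 + U.1) i 0 with hB
  have hdet : B.det = (1 + U.1).det := by
    rw [← Matrix.det_transpose B, ← Matrix.det_transpose (1 + U.1)]
    refine Matrix.det_eq_of_forall_row_eq_smul_add_const (Fin.cases 0 (clearCoeff U)) 0 rfl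
      fun i j => rfl
  rw [← hdet, Matrix.det_succ_row_zero, Fin.sum_univ_succ, Finset.sum_eq_zero, add_zero]
  · have h00 : B 0 0 = 1 + U.1 0 0 := by simp [hB]
    rw [h00]
    simp only [Fin.val_zero, pow_zero, one_mul, Fin.succAbove_zero]
    congr 2
    ext i j
    simp [hB, schurReduce, Matrix.one_apply]
    ring
  · intro j _
    have : B 0 j.succ = 0 := by
      simp only [hB, Matrix.of_apply, Matrix.add_apply, Fin.cases_succ, Matrix.one_apply_eq]
      rw [row_zero_eq_neg_mul_clearCoeff U j, Matrix.one_apply_ne (Fin.succ_ne_zero j).symm]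
      ring
    rw [this]; simp

/-- The block diagonal unitary matrix `diag(1, h)`. -/
noncomputable def oneBlock (h : Matrix.unitaryGroup (Fin n) ℂ) :
    Matrix.unitaryGroup (Fin (n + 1)) ℂ :=
  ⟨Matrix.of fun i j => Fin.cases (Fin.cases 1 (fun _ => 0) j)
    (fun i' => Fin.cases 0 (fun j' => h.1 i' j') j) i, by
    rw [Matrix.mem_unitaryGroup_iff']
    ext i j
    rw [Matrix.mul_apply, Matrix.one_apply, Fin.sum_univ_succ]
    have h1 := unitary_star_mul_apply h
    refine Fin.cases ?_ (fun i => ?_) i <;> refine Fin.cases ?_ (fun j => ?_) j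
    · simp [Matrix.star_apply]
    · simp [Matrix.star_apply, (Fin.succ_ne_zero j).symm]
    · simp [Matrix.star_apply]
    · simpa [Matrix.star_apply] using h1 i j⟩

theorem oneBlock_mul_apply_zero (h : Matrix.unitaryGroup (Fin n) ℂ)
    (U : Matrix.unitaryGroup (Fin (n + 1)) ℂ) (j : Fin (n + 1)) :
    (oneBlock h * U).1 0 j = U.1 0 j := by
  change ((oneBlock h).1 * U.1) 0 j = _
  rw [Matrix.mul_apply, Fin.sum_univ_succ]
  simp [oneBlock]

theorem oneBlock_mul_apply_succ (h : Matrix.unitaryGroup (Fin n) ℂ)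
    (U : Matrix.unitaryGroup (Fin (n + 1)) ℂ) (i : Fin n) (j : Fin (n + 1)) :
    (oneBlock h * U).1 i.succ j = ∑ k, h.1 i k * U.1 k.succ j := by
  change ((oneBlock h).1 * U.1) i.succ j = _
  rw [Matrix.mul_apply, Fin.sum_univ_succ]
  simp [oneBlock]

/-- `clearCoeff` sees only row 0, which diag(1, h) fixes, while h acts linearly on the other rows.
-/
theorem schurReduce_oneBlock_mul (h : Matrix.unitaryGroup (Fin n) ℂ)
    (U : Matrix.unitaryGroup (Fin (n + 1)) ℂ) :
    schurReduce (oneBlock h * U) = h * schurReduce U := by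
  ext i j
  change (oneBlock h * U).1 i.succ j.succ + (oneBlock h * U).1 i.succ 0 *
    clearCoeff (oneBlock h * U) j = (h.1 * (schurReduce U).1) i j
  have hcc : clearCoeff (oneBlock h * U) j = clearCoeff U j := by
    simp only [clearCoeff, oneBlock_mul_apply_zero]
  rw [Matrix.mul_apply, hcc, oneBlock_mul_apply_succ, oneBlock_mul_apply_succ, Finset.sum_mul,
    ← Finset.sum_add_distrib]
  refine Finset.sum_congr rfl fun k _ => ?_
  simp only [schurReduce, Matrix.of_apply]
  ring

theorem measurable_schurReduce [MeasurableSpace (Matrix.unitaryGroup (Fin (n + 1)) ℂ)]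
    [BorelSpace (Matrix.unitaryGroup (Fin (n + 1)) ℂ)]
    [MeasurableSpace (Matrix.unitaryGroup (Fin n) ℂ)]
    [BorelSpace (Matrix.unitaryGroup (Fin n) ℂ)] :
    Measurable (schurReduce : Matrix.unitaryGroup (Fin (n + 1)) ℂ → _) := by
  have hemb : MeasurableEmbedding
      (fun (V : Matrix.unitaryGroup (Fin n) ℂ) (i j : Fin n) => V.1 i j) := by
    refine (Continuous.isClosedEmbedding ?_ ?_).measurableEmbedding
    · exact continuous_pi fun i => continuous_pi fun j => continuous_unitaryGroup_apply i j
    · intro V W h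
      ext i j
      exact congrFun (congrFun h i) j
  rw [← hemb.measurable_comp_iff]
  have he : ∀ i j : Fin (n + 1), Measurable fun U : Matrix.unitaryGroup (Fin (n + 1)) ℂ => U.1 i j :=
    fun i j => (continuous_unitaryGroup_apply i j).measurable
  refine measurable_pi_lambda _ fun i => measurable_pi_lambda _ fun j => ?_
  exact (he _ _).add ((he _ _).mul ((he _ _).div (measurable_const.add (he _ _))).neg)

theorem continuous_norm_det_one_add_pow {m : ℕ} (k : ℕ) :
    Continuous fun U : Matrix.unitaryGroup (Fin m) ℂ => ‖(1 + U.1).det‖ ^ k :=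
  ((continuous_const.add continuous_subtype_val).matrix_det.norm).pow k

/-- The even moments of the modulus of the characteristic polynomial at `-1` under Haar measure. -/
theorem integral_norm_det_one_add_pow (n : ℕ) [mU : MeasurableSpace (Matrix.unitaryGroup (Fin n) ℂ)]
    [bU : BorelSpace (Matrix.unitaryGroup (Fin n) ℂ)] (σ : Measure (Matrix.unitaryGroup (Fin n) ℂ))
    [hp : IsProbabilityMeasure σ] [hi : σ.IsMulLeftInvariant] (k : ℕ) :
    ∫ U, ‖(1 + U.1).det‖ ^ (2 * k) ∂σ =
      ∏ j ∈ Finset.range n, ((2 * k + j)! : ℝ) * j ! / ((k + j)! : ℝ) ^ 2 := by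
  revert mU bU σ hp hi
  induction n with
  | zero => intro _ _ σ _ _; simp
  | succ n ih =>
    intro _ _ σ _ _
    let : MeasurableSpace (Matrix.unitaryGroup (Fin n) ℂ) := borel _
    have : BorelSpace (Matrix.unitaryGroup (Fin n) ℂ) := ⟨rfl⟩
    have : IsProbabilityMeasure (σ.map schurReduce) :=
      Measure.isProbabilityMeasure_map measurable_schurReduce.aemeasurable
    have := isMulLeftInvariant_map_of_equivariant σ measurable_schurReduce
      schurReduce_oneBlock_mul
    have hfc : Continuous fun U : Matrix.unitaryGroup (Fin (n + 1)) ℂ => ‖1 + U.1 0 0‖ ^ (2 * k) :=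
      ((continuous_const.add (continuous_unitaryGroup_apply 0 0)).norm).pow _
    have hgc := continuous_norm_det_one_add_pow (m := n) (2 * k)
    obtain ⟨A, hA⟩ := isCompact_univ.exists_bound_of_continuousOn hfc.continuousOn
    obtain ⟨B, hB⟩ := isCompact_univ.exists_bound_of_continuousOn hgc.continuousOn
    -- The induction hypothesis applies to the law of `schurReduce`, itself a left invariant
    -- probability measure; the factor |1 + U₀₀| is unchanged by `oneBlock`, hence uncorrelated with
    -- it.
    rw [Finset.prod_range_succ, ← ih (σ.map schurReduce), ← integral_norm_one_add_entry_pow σ,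
      mul_comm (∫ U, _ ∂(σ.map schurReduce)), ← integral_mul_comp_eq_of_equivariant σ measurable_schurReduce
        schurReduce_oneBlock_mul hfc.measurable
        (fun h U => by rw [oneBlock_mul_apply_zero]) (fun U => hA U trivial) hgc.measurable
        (fun U => hB U trivial)]
    simp only [det_one_add_eq_mul_det_schurReduce, norm_mul, mul_pow]

end Reduction

/-! ### Comparison of |det((1 + U)/2)|² with the Hilbert–Schmidt distance to I. -/

section Geometry

open scoped ComplexOrder

theorem one_sub_sum_one_sub_le_prod {ι : Type*} (s : Finset ι) (y : ι → ℝ)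
    (hy : ∀ i ∈ s, 0 ≤ y i ∧ y i ≤ 1) : 1 - ∑ i ∈ s, (1 - y i) ≤ ∏ i ∈ s, y i := by
  classical
  induction s using Finset.induction_on with
  | empty => simp
  | insert a s ha ih =>
    rw [Finset.sum_insert ha, Finset.prod_insert ha]
    have h1 := ih fun i hi => hy i (Finset.mem_insert_of_mem hi)
    have h2 := hy a (Finset.mem_insert_self a s)
    have h3 : ∏ i ∈ s, y i ≤ 1 := Finset.prod_le_one
      (fun i hi => (hy i (Finset.mem_insert_of_mem hi)).1)
      (fun i hi => (hy i (Finset.mem_insert_of_mem hi)).2)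
    nlinarith

theorem prod_le_exp_neg_sum_one_sub {ι : Type*} (s : Finset ι) (y : ι → ℝ)
    (hy : ∀ i ∈ s, 0 ≤ y i) : ∏ i ∈ s, y i ≤ Real.exp (-∑ i ∈ s, (1 - y i)) := by
  rw [← Finset.sum_neg_distrib, Real.exp_sum]
  refine Finset.prod_le_prod hy fun i _ => ?_
  have := Real.add_one_le_exp (-(1 - y i))
  linarith

variable {N : ℕ}

theorem trace_conjTranspose_mul_self_eq_hsNorm_sq (M : Matrix (Fin N) (Fin N) ℂ) :
    (M.conjTranspose * M).trace = ((hsNorm M ^ 2 : ℝ) : ℂ) := by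
  rw [hsNorm, Real.sq_sqrt (by positivity), Finset.sum_comm]
  simp only [Matrix.trace, Matrix.diag_apply, Matrix.mul_apply, Matrix.conjTranspose_apply]
  push_cast
  refine Finset.sum_congr rfl fun i _ => Finset.sum_congr rfl fun j _ => ?_
  rw [mul_comm]
  exact Complex.mul_conj' _

/-- The squared modulus of `det ((1 + U) / 2)`. -/
noncomputable def normSqDetHalf (U : Matrix.unitaryGroup (Fin N) ℂ) : ℝ :=
  ‖(1 + U.1).det‖ ^ 2 / 4 ^ N

/-- A = (1 + U)*(1 + U)/4 and B = (1 - U)*(1 - U)/4 are positive semidefinite with A + B = 1, so the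
eigenvalues y of A lie in [0, 1]. Then det A = ∏ y is the middle term and tr B = ∑ (1 - y) is the
squared distance over 4. -/
theorem normSqDetHalf_bounds (U : Matrix.unitaryGroup (Fin N) ℂ) :
    1 - hsNorm (1 - U.1) ^ 2 / 4 ≤ normSqDetHalf U ∧
      normSqDetHalf U ≤ Real.exp (-(hsNorm (1 - U.1) ^ 2 / 4)) := by
  set A : Matrix (Fin N) (Fin N) ℂ := (4⁻¹ : ℝ) • ((1 + U.1).conjTranspose * (1 + U.1)) with hA
  set B : Matrix (Fin N) (Fin N) ℂ := (4⁻¹ : ℝ) • ((1 - U.1).conjTranspose * (1 - U.1)) with hB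
  have hApos : A.PosSemidef :=
    (Matrix.posSemidef_conjTranspose_mul_self _).smul (by norm_num)
  have hBpos : B.PosSemidef :=
    (Matrix.posSemidef_conjTranspose_mul_self _).smul (by norm_num)
  have hU : U.1.conjTranspose * U.1 = 1 := Matrix.mem_unitaryGroup_iff'.1 U.2
  have hAB : A = 1 - B := by
    have : (1 + U.1).conjTranspose * (1 + U.1) = (4 : ℝ) • 1 - (1 - U.1).conjTranspose * (1 - U.1) := by
      rw [Matrix.conjTranspose_add, Matrix.conjTranspose_sub, Matrix.conjTranspose_one, add_mul,
        mul_add, mul_add, sub_mul, mul_sub, mul_sub, hU]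
      simp only [one_mul, mul_one]
      rw [show (4 : ℝ) • (1 : Matrix (Fin N) (Fin N) ℂ) = 1 + 1 + 1 + 1 by
        rw [show (4 : ℝ) = 1 + 1 + 1 + 1 by norm_num]; simp only [add_smul, one_smul]]
      abel
    rw [hA, hB, this, smul_sub, smul_smul]
    norm_num
  set y := hApos.isHermitian.eigenvalues with hy
  have hy0 : ∀ i, 0 ≤ y i := hApos.eigenvalues_nonneg
  have hy1 : ∀ i, y i ≤ 1 := by
    intro i
    have hunit : RCLike.re (dotProduct (star ⇑(hApos.isHermitian.eigenvectorBasis i))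
        ⇑(hApos.isHermitian.eigenvectorBasis i)) = (1 : ℝ) := by
      rw [dotProduct_comm, ← EuclideanSpace.inner_eq_star_dotProduct, inner_self_eq_norm_sq_to_K,
        hApos.isHermitian.eigenvectorBasis.orthonormal.1 i]
      simp
    have hpos := hBpos.re_dotProduct_nonneg ⇑(hApos.isHermitian.eigenvectorBasis i)
    have h := hApos.isHermitian.eigenvalues_eq i
    rw [← hy] at h
    rw [h]
    have hmul : ∀ v : Fin N → ℂ, A.mulVec v = v - B.mulVec v := fun v => by
      rw [hAB, Matrix.sub_mulVec, Matrix.one_mulVec]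
    rw [hmul, dotProduct_sub, map_sub, hunit]
    linarith
  have hdet : normSqDetHalf U = ∏ i, y i := by
    have h1 : A.det = ∏ i, (y i : ℂ) := hApos.isHermitian.det_eq_prod_eigenvalues
    rw [hA, ← algebraMap_smul ℂ, Matrix.det_smul, Matrix.det_mul, Matrix.det_conjTranspose,
      mul_comm (star _)] at h1
    have h2 : (1 + U.1).det * star (1 + U.1).det = ((‖(1 + U.1).det‖ ^ 2 : ℝ) : ℂ) := by
      push_cast; exact Complex.mul_conj' _
    rw [h2, Fintype.card_fin] at h1
    apply Complex.ofReal_injective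
    rw [normSqDetHalf]
    push_cast at h1 ⊢
    refine Eq.trans ?_ h1
    simp
    ring
  have htr : ∑ i, (1 - y i) = hsNorm (1 - U.1) ^ 2 / 4 := by
    have h1 : A.trace = ∑ i, (y i : ℂ) := hApos.isHermitian.trace_eq_sum_eigenvalues
    rw [hAB, Matrix.trace_sub, hB, Matrix.trace_smul,
      trace_conjTranspose_mul_self_eq_hsNorm_sq, Matrix.trace_one] at h1
    have h3 : (N : ℝ) - 4⁻¹ * hsNorm (1 - U.1) ^ 2 = ∑ i, y i := by
      apply Complex.ofReal_injective
      push_cast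
      simpa using h1
    rw [Finset.sum_sub_distrib, ← h3]
    simp
    ring
  rw [hdet, ← htr]
  exact ⟨one_sub_sum_one_sub_le_prod _ _ fun i _ => ⟨hy0 i, hy1 i⟩,
    prod_le_exp_neg_sum_one_sub _ _ fun i _ => hy0 i⟩

end Geometry

/-! ### Asymptotics of the moments. -/

section Asymptotics

/-- The square of the expression is k/(2k + 1) divided by the Wallis product, which tends to π/2. -/
theorem tendsto_sqrt_mul_centralBinom :
    Tendsto (fun k : ℕ => (k : ℝ) ^ (1 / 2 : ℝ) * (((2 * k)! : ℝ) / ((k ! : ℝ) ^ 2 * 4 ^ k))) atTop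
      (𝓝 (1 / √Real.pi)) := by
  have hW := Real.Wallis.tendsto_W_nhds_pi_div_two
  have hfrac : Tendsto (fun k : ℕ => (k : ℝ) / (2 * k + 1)) atTop (𝓝 (1 / 2)) := by
    have h1 : Tendsto (fun k : ℕ => 1 / (2 + 1 / (k : ℝ))) atTop (𝓝 (1 / (2 + 0))) :=
      (tendsto_const_nhds.div (tendsto_const_nhds.add tendsto_one_div_atTop_nhds_zero_nat)
        (by norm_num))
    rw [add_zero] at h1
    refine h1.congr' ?_
    filter_upwards [eventually_gt_atTop 0] with k hk
    have : (k : ℝ) ≠ 0 := by positivity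
    field_simp
  have hdiv := hfrac.div hW (by positivity)
  have hsq := (Real.continuous_sqrt.tendsto _).comp hdiv
  have hlim : √(1 / 2 / (Real.pi / 2)) = 1 / √Real.pi := by
    rw [show 1 / 2 / (Real.pi / 2) = 1 / Real.pi by field_simp, Real.sqrt_div zero_le_one,
      Real.sqrt_one]
  rw [hlim] at hsq
  refine hsq.congr fun k => ?_
  simp only [Function.comp_apply, Pi.div_apply]
  rw [Real.Wallis.W_eq_factorial_ratio, ← Real.sqrt_eq_rpow]
  have : (k : ℝ) / (2 * k + 1) / (2 ^ (4 * k) * (k ! : ℝ) ^ 4 / (((2 * k)! : ℝ) ^ 2 * (2 * k + 1))) =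
      k * (((2 * k)! : ℝ) / ((k ! : ℝ) ^ 2 * 4 ^ k)) ^ 2 := by
    rw [show (2 : ℝ) ^ (4 * k) = (4 ^ k) ^ 2 by
      rw [show (4 : ℝ) = 2 ^ 2 by norm_num, ← pow_mul, ← pow_mul]; congr 1; ring]
    field_simp
  rw [this, Real.sqrt_mul (Nat.cast_nonneg k), Real.sqrt_sq (by positivity)]

/-- Passing from j to j + 1 multiplies the ratio by (2k + j + 1)(j + 1)/(k + j + 1)², which is
asymptotic to 2(j + 1)/k. -/
theorem tendsto_rpow_mul_factorial_ratio (j : ℕ) :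
    Tendsto (fun k : ℕ => (k : ℝ) ^ ((j : ℝ) + 1 / 2) *
      (((2 * k + j)! : ℝ) * j ! / ((k + j)! : ℝ) ^ 2 / 4 ^ k)) atTop
      (𝓝 ((j ! : ℝ) * 2 ^ j / √Real.pi)) := by
  induction j with
  | zero =>
    refine (tendsto_sqrt_mul_centralBinom.congr fun k => ?_).trans (by simp)
    simp [div_div]
  | succ j ih =>
    have hstep : Tendsto (fun k : ℕ => (k : ℝ) *
        ((2 * k + j + 1) * ((j : ℝ) + 1) / (k + j + 1) ^ 2)) atTop (𝓝 (2 * ((j : ℝ) + 1))) := by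
      have hc : ∀ c : ℝ, Tendsto (fun k : ℕ => c / (k : ℝ)) atTop (𝓝 0) :=
        tendsto_const_div_atTop_nhds_zero_nat
      have h1 : Tendsto (fun k : ℕ => (2 + ((j : ℝ) + 1) / k) * (j + 1) / (1 + ((j : ℝ) + 1) / k) ^ 2)
          atTop (𝓝 ((2 + 0) * ((j : ℝ) + 1) / (1 + 0) ^ 2)) :=
        ((tendsto_const_nhds.add (hc _)).mul_const _).div ((tendsto_const_nhds.add (hc _)).pow 2)
          (by norm_num)
      rw [show (2 + 0 : ℝ) * ((j : ℝ) + 1) / (1 + 0) ^ 2 = 2 * ((j : ℝ) + 1) by ring] at h1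
      refine h1.congr' ?_
      filter_upwards [eventually_gt_atTop 0] with k hk
      have : (0 : ℝ) < k := by positivity
      field_simp
      ring
    have key := ih.mul hstep
    have hlim : (j ! : ℝ) * 2 ^ j / √Real.pi * (2 * (j + 1)) =
        ((j + 1)! : ℝ) * 2 ^ (j + 1) / √Real.pi := by
      rw [Nat.factorial_succ]; push_cast; ring
    rw [hlim] at key
    refine key.congr' ?_
    filter_upwards [eventually_gt_atTop 0] with k hk
    have hk0 : (0 : ℝ) < k := by positivity
    rw [show ((j + 1 : ℕ) : ℝ) + 1 / 2 = ((j : ℝ) + 1 / 2) + 1 by push_cast; ring,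
      Real.rpow_add_one hk0.ne', ← add_assoc, ← add_assoc, Nat.factorial_succ (2 * k + j),
      Nat.factorial_succ (k + j), Nat.factorial_succ j]
    push_cast
    field_simp

/-- The exponents j + 1/2 for j < N add up to N²/2. -/
theorem tendsto_rpow_mul_prod_factorial_ratio (N : ℕ) :
    Tendsto (fun k : ℕ => (k : ℝ) ^ ((N : ℝ) ^ 2 / 2) *
      ∏ j ∈ Finset.range N, (((2 * k + j)! : ℝ) * j ! / ((k + j)! : ℝ) ^ 2 / 4 ^ k)) atTop
      (𝓝 (∏ j ∈ Finset.range N, ((j ! : ℝ) * 2 ^ j / √Real.pi))) := by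
  induction N with
  | zero => simp
  | succ N ih =>
    rw [Finset.prod_range_succ]
    refine (ih.mul (tendsto_rpow_mul_factorial_ratio N)).congr' ?_
    filter_upwards [eventually_gt_atTop 0] with k hk
    have hk0 : (0 : ℝ) < k := by positivity
    rw [Finset.prod_range_succ, show ((N + 1 : ℕ) : ℝ) ^ 2 / 2 = (N : ℝ) ^ 2 / 2 + ((N : ℝ) + 1 / 2) by
      push_cast; ring, Real.rpow_add hk0 ((N : ℝ) ^ 2 / 2)]
    exact mul_mul_mul_comm _ _ _ _

end Asymptotics

/-! ### The constant and the passage to balls. -/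

section Limit

theorem prod_factorial_div_eq (N : ℕ) :
    (∏ j ∈ Finset.range N, ((j ! : ℝ) * 2 ^ j / √Real.pi)) / 2 ^ (N ^ 2) =
      (∏ j ∈ Finset.range N, (j ! : ℝ)) /
        ((2 * Real.pi) ^ ((N : ℝ) / 2) * (2 : ℝ) ^ ((N : ℝ) ^ 2 / 2)) := by
  induction N with
  | zero => simp
  | succ N ih =>
    have h2π : (0 : ℝ) < 2 * Real.pi := by positivity
    have hexp : ((N + 1 : ℕ) : ℝ) / 2 = (N : ℝ) / 2 + 1 / 2 := by push_cast; ring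
    have hexp' : ((N + 1 : ℕ) : ℝ) ^ 2 / 2 = (N : ℝ) ^ 2 / 2 + ((N : ℝ) + 1 / 2) := by
      push_cast; ring
    have hsq : √(2 : ℝ) * √2 = 2 := Real.mul_self_sqrt zero_le_two
    rw [Finset.prod_range_succ, Finset.prod_range_succ, hexp, hexp', Real.rpow_add h2π,
      Real.rpow_add two_pos ((N : ℝ) ^ 2 / 2), Real.rpow_add two_pos (N : ℝ), Real.rpow_natCast,
      ← Real.sqrt_eq_rpow, ← Real.sqrt_eq_rpow, Real.sqrt_mul zero_le_two,
      show (N + 1) ^ 2 = N ^ 2 + (2 * N + 1) by ring, pow_add]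
    have h3 : (N ! : ℝ) * 2 ^ N / √Real.pi / 2 ^ (2 * N + 1) =
        (N ! : ℝ) / (√2 * √Real.pi * (2 ^ N * √2)) := by
      rw [show √2 * √Real.pi * (2 ^ N * √2) = (√2 * √2) * √Real.pi * 2 ^ N by ring, hsq,
        pow_succ, two_mul, pow_add]
      field_simp
    rw [mul_div_mul_comm, ih, h3, div_mul_div_comm]
    congr 1
    ring

theorem prod_range_factorial_eq_prod_Icc {N : ℕ} (hN : 1 ≤ N) :
    ∏ j ∈ Finset.range N, (j ! : ℝ) = ∏ j ∈ Finset.Icc 1 (N - 1), (j ! : ℝ) := by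
  obtain ⟨m, rfl⟩ := Nat.exists_eq_add_of_le' hN
  rw [Finset.range_eq_Ico, Finset.prod_eq_prod_Ico_succ_bot (Nat.succ_pos m)]
  simp only [Nat.factorial_zero, Nat.cast_one, one_mul, zero_add, Nat.add_sub_cancel]
  rfl

theorem tendsto_neg_log_one_sub_div :
    Tendsto (fun x : ℝ => -Real.log (1 - x) / x) (𝓝[>] 0) (𝓝 1) := by
  have hd : HasDerivAt (fun x : ℝ => -Real.log (1 - x)) 1 0 := by
    have := (((hasDerivAt_id (0 : ℝ)).const_sub 1).log (by simp)).fun_neg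
    simpa using this
  have := hd.tendsto_slope_zero_right
  simpa [div_eq_inv_mul] using this

theorem tendsto_sq_div_four_nhdsGT_zero :
    Tendsto (fun δ : ℝ => δ ^ 2 / 4) (𝓝[>] 0) (𝓝[>] 0) := by
  refine tendsto_nhdsWithin_iff.2 ⟨?_, ?_⟩
  · have : Tendsto (fun δ : ℝ => δ ^ 2 / 4) (𝓝 0) (𝓝 (0 ^ 2 / 4)) :=
      (by fun_prop : Continuous fun δ : ℝ => δ ^ 2 / 4).tendsto 0
    simpa using this.mono_left nhdsWithin_le_nhds
  · filter_upwards [eventually_mem_nhdsWithin] with δ hδ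
    have : 0 < δ := hδ
    exact Set.mem_Ioi.2 (by positivity)

theorem tendsto_neg_log_one_sub_nhdsGT_zero :
    Tendsto (fun x : ℝ => -Real.log (1 - x)) (𝓝[>] 0) (𝓝[>] 0) := by
  refine tendsto_nhdsWithin_iff.2 ⟨?_, ?_⟩
  · have hc : ContinuousAt (fun x : ℝ => -Real.log (1 - x)) 0 :=
      ((continuousAt_const.sub continuousAt_id).log (by simp)).neg
    have := hc.tendsto.mono_left (nhdsWithin_le_nhds (s := Set.Ioi 0))
    simpa using this
  · filter_upwards [Ioo_mem_nhdsGT (zero_lt_one' ℝ)] with x hx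
    exact Set.mem_Ioi.2 (neg_pos.2 (Real.log_neg (by linarith [hx.2]) (by linarith [hx.1])))

variable {N : ℕ}

theorem continuous_normSqDetHalf : Continuous (normSqDetHalf (N := N)) :=
  (continuous_norm_det_one_add_pow 2).div_const _

theorem normSqDetHalf_mem_Icc (U : Matrix.unitaryGroup (Fin N) ℂ) :
    normSqDetHalf U ∈ Set.Icc (0 : ℝ) 1 :=
  ⟨by unfold normSqDetHalf; positivity, (normSqDetHalf_bounds U).2.trans
    (Real.exp_le_one_iff.2 (neg_nonpos.2 (by positivity)))⟩

variable [MeasurableSpace (Matrix.unitaryGroup (Fin N) ℂ)]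
  [BorelSpace (Matrix.unitaryGroup (Fin N) ℂ)] (σ : Measure (Matrix.unitaryGroup (Fin N) ℂ))
  [IsProbabilityMeasure σ] [σ.IsMulLeftInvariant]

theorem integral_normSqDetHalf_pow (k : ℕ) :
    ∫ U, normSqDetHalf U ^ k ∂σ =
      ∏ j ∈ Finset.range N, (((2 * k + j)! : ℝ) * j ! / ((k + j)! : ℝ) ^ 2 / 4 ^ k) := by
  rw [Finset.prod_div_distrib, ← integral_norm_det_one_add_pow N σ k, Finset.prod_const,
    Finset.card_range, ← integral_div]
  refine integral_congr_ae (Eventually.of_forall fun U => ?_)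
  simp only [normSqDetHalf]
  rw [div_pow, ← pow_mul, ← pow_mul, ← pow_mul, mul_comm N k]

theorem tendsto_measureReal_normSqDetHalf (hN : 1 ≤ N) :
    Tendsto (fun r : ℝ => σ.real {U | Real.exp (-r) ≤ normSqDetHalf U} / r ^ ((N : ℝ) ^ 2 / 2)) (𝓝[>] 0)
      (𝓝 ((∏ j ∈ Finset.range N, ((j ! : ℝ) * 2 ^ j / √Real.pi)) /
        Real.Gamma ((N : ℝ) ^ 2 / 2 + 1))) := by
  have hN' : (0 : ℝ) < N := by exact_mod_cast hN
  refine tendsto_measureReal_exp_neg_le_div_rpow (by positivity) continuous_normSqDetHalf.measurable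
    normSqDetHalf_mem_Icc ?_
  simp only [integral_normSqDetHalf_pow]
  exact tendsto_rpow_mul_prod_factorial_ratio N

/-- The ball lies between the level sets with r = δ²/4 and r = -log(1 - δ²/4). Both r are asymptotic
to δ²/4, and (δ²/4)^(N²/2) = δ^(N²)/2^(N²) accounts for the extra power of 2. -/
theorem tendsto_measureReal_hsNorm_le (hN : 1 ≤ N) :
    Tendsto (fun δ : ℝ => σ.real {U | hsNorm (1 - U.1) ≤ δ} / δ ^ (N ^ 2)) (𝓝[>] 0)
      (𝓝 ((∏ j ∈ Finset.range N, ((j ! : ℝ) * 2 ^ j / √Real.pi)) /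
        Real.Gamma ((N : ℝ) ^ 2 / 2 + 1) / 2 ^ (N ^ 2))) := by
  have hmain := tendsto_measureReal_normSqDetHalf σ hN
  set L := (∏ j ∈ Finset.range N, ((j ! : ℝ) * 2 ^ j / √Real.pi)) /
    Real.Gamma ((N : ℝ) ^ 2 / 2 + 1)
  set F : ℝ → ℝ := fun r => σ.real {U | Real.exp (-r) ≤ normSqDetHalf U}
  change Tendsto (fun r : ℝ => F r / r ^ ((N : ℝ) ^ 2 / 2)) _ _ at hmain
  have hrpow : ∀ δ : ℝ, 0 < δ → (δ ^ 2 / 4) ^ ((N : ℝ) ^ 2 / 2) = δ ^ (N ^ 2) / 2 ^ (N ^ 2) := by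
    intro δ hδ
    rw [show δ ^ 2 / 4 = (δ / 2) ^ 2 by ring, ← Real.rpow_natCast (δ / 2) 2,
      ← Real.rpow_mul (by positivity), ← div_pow, ← Real.rpow_natCast (δ / 2) (N ^ 2)]
    congr 1
    push_cast
    ring
  have hlow : Tendsto (fun δ : ℝ => F (δ ^ 2 / 4) / δ ^ (N ^ 2)) (𝓝[>] 0)
      (𝓝 (L / 2 ^ (N ^ 2))) := by
    refine ((hmain.comp tendsto_sq_div_four_nhdsGT_zero).div_const (2 ^ (N ^ 2))).congr' ?_
    filter_upwards [eventually_mem_nhdsWithin] with δ hδ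
    have hδ' : 0 < δ := hδ
    simp only [Function.comp_apply, hrpow δ hδ']
    field_simp
  have hup : Tendsto (fun δ : ℝ => F (-Real.log (1 - δ ^ 2 / 4)) / δ ^ (N ^ 2)) (𝓝[>] 0)
      (𝓝 (L / 2 ^ (N ^ 2))) := by
    have h1 := (hmain.comp tendsto_neg_log_one_sub_nhdsGT_zero).mul
      (tendsto_neg_log_one_sub_div.rpow_const (p := (N : ℝ) ^ 2 / 2) (Or.inl one_ne_zero))
    rw [Real.one_rpow, mul_one] at h1
    refine ((h1.comp tendsto_sq_div_four_nhdsGT_zero).div_const (2 ^ (N ^ 2))).congr' ?_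
    filter_upwards [eventually_mem_nhdsWithin, tendsto_sq_div_four_nhdsGT_zero.eventually
      (tendsto_neg_log_one_sub_nhdsGT_zero.eventually eventually_mem_nhdsWithin)] with δ hδ hlog
    have hδ' : 0 < δ := hδ
    have hlog' : 0 < -Real.log (1 - δ ^ 2 / 4) := hlog
    simp only [Function.comp_apply]
    generalize -Real.log (1 - δ ^ 2 / 4) = s at hlog' ⊢
    rw [Real.div_rpow hlog'.le (by positivity), hrpow δ hδ']
    have := (Real.rpow_pos_of_pos hlog' ((N : ℝ) ^ 2 / 2)).ne'
    field_simp
  refine tendsto_of_tendsto_of_tendsto_of_le_of_le' hlow hup ?_ ?_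
  · filter_upwards [eventually_mem_nhdsWithin] with δ hδ
    have hδ' : 0 < δ := hδ
    refine div_le_div_of_nonneg_right (measureReal_mono fun U hU => ?_) (by positivity)
    have h1 := Real.exp_le_exp.1 (le_trans hU (normSqDetHalf_bounds U).2)
    exact (pow_le_pow_iff_left₀ (Real.sqrt_nonneg _) hδ'.le two_ne_zero).1
      (show hsNorm (1 - U.1) ^ 2 ≤ δ ^ 2 by linarith)
  · filter_upwards [eventually_mem_nhdsWithin, tendsto_sq_div_four_nhdsGT_zero.eventually
      (Ioo_mem_nhdsGT (zero_lt_one' ℝ))] with δ hδ hδ1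
    have hδ' : 0 < δ := hδ
    refine div_le_div_of_nonneg_right (measureReal_mono fun U hU => ?_) (by positivity)
    change Real.exp (- -Real.log (1 - δ ^ 2 / 4)) ≤ normSqDetHalf U
    rw [neg_neg, Real.exp_log (by linarith [hδ1.2])]
    have h1 : hsNorm (1 - U.1) ^ 2 ≤ δ ^ 2 := pow_le_pow_left₀ (Real.sqrt_nonneg _) hU 2
    linarith [(normSqDetHalf_bounds U).1]

end Limit

/-- Here `σ` is the Haar probability measure on the unitary group `U(N)`, on the Borel σ-algebra of
the topology inherited from the space of complex matrices, and the ball is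
taken in the Hilbert–Schmidt norm. -/
theorem theorem6p1 (N : ℕ) (hN : 1 ≤ N)
    [MeasurableSpace (Matrix.unitaryGroup (Fin N) ℂ)] [BorelSpace (Matrix.unitaryGroup (Fin N) ℂ)]
    (σ : Measure (Matrix.unitaryGroup (Fin N) ℂ)) [σ.IsHaarMeasure] [IsProbabilityMeasure σ] :
    Tendsto
      (fun δ : ℝ =>
        σ.real {U : Matrix.unitaryGroup (Fin N) ℂ |
          hsNorm ((1 : Matrix (Fin N) (Fin N) ℂ) - (U : Matrix (Fin N) (Fin N) ℂ)) ≤ δ} / δ ^ (N ^ 2))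
      (𝓝[>] 0)
      (𝓝 ((∏ j ∈ Finset.Icc 1 (N - 1), (j ! : ℝ)) /
        ((2 * Real.pi) ^ ((N : ℝ) / 2) * (2 : ℝ) ^ ((N : ℝ) ^ 2 / 2) *
          Real.Gamma ((N : ℝ) ^ 2 / 2 + 1)))) := by
  have h := tendsto_measureReal_hsNorm_le σ hN
  rwa [div_right_comm, prod_factorial_div_eq, div_div, prod_range_factorial_eq_prod_Icc hN] at h
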